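/- **Setting.** Let $a=\mathrm{diag}(a_1,\dots,a_n)\in sl(n,\mathbb C)$ be non-zero, $b=p(a)$ for a polynomial $p$, and $j\ge 1$ an integer. Let $sl(n)_a=\{y\in sl(n,\mathbb C): [a,y]=0\}$, let $sl(n)_a^\perp$ be its orthogonal complement in $sl(n,\mathbb C)$ for the form $\mathrm{tr}(yz)$, and let $\Gamma_a=\{\lambda\in\mathbb C:\ \mathrm{Re}(\lambda(a_i-a_k))=0\text{ for some } a_i\ne a_k\}$. For smooth $u$ with values in $sl(n)_a^\perp$, the polynomial differential operators $Q_{a,k}(u)$ are the ones determined by $Q_{a,0}=a$, $(Q_{a,k})_x+[u,Q_{a,k}]=[Q_{a,k+1},a]$ and $f\big(\sum_k Q_{a,k}\lambda^{-k}\big)=0$, where $f$ is the minimal polynomial of $a$; and $\sum_k Q_{b,k}(u)\lambda^{-k}=p\big(\sum_kQ_{a,k}(u)\lambda^{-k}\big)$. The $j$-th flow is $u_t=(Q_{b,j}(u))_x+[u,Q_{b,j}(u)]$. A trivialization of a solution $u:\mathcal O\to sl(n)_a^\perp$ on an open set $\mathcal O\ni(0,0)$ of $\mathbb R^2$ is a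 smooth $E:\mathcal O\times\mathbb C\to GL(n,\mathbb C)$ with $$E_x=E(a\lambda+u),\qquad E_t=E\big(b\lambda^j+Q_{b,1}(u)\lambda^{j-1}+\cdots+Q_{b,j}(u)\big),\qquad E(0,0,\lambda)=I .$$ Let $W\cup\{\infty\}$ ($W\subset\mathbb C$) be an open neighborhood of $\infty$ in the Riemann sphere. A local reduced wave function of $u$ (with trivialization $E$) on $W$ is a map $m(x,t,\lambda)$, meromorphic in $\lambda\in W\setminus\Gamma_a$ and, off a bounded set $S$ of exceptional points without accumulation point in $W\setminus\Gamma_a$, smooth in $(x,t,\lambda)$, holomorphic in $\lambda$ and $GL(n,\mathbb C)$-valued, such that $m\sim I+m_1(x,t)\lambda^{-1}+m_2(x,t)\lambda^{-2}+\cdots$ as $\lambda\to\infty$ in $\mathbb C\setminus\Gamma_a$, with smooth coefficients and locally uniformly in $(x,t)$, $u=[a,m_1]$, $E$ is entire in $\lambda$, and $E(x,t,\lambda)=m(0,0,\lambda)^{-1}e^{a\lambda x+b\lambda^jt}m(x,t,\lambda)$ for $\lambda\in W\setminus(\Gamma_a\cup S)$. For $\alpha_1,\alpha_2\in\mathbb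 C$ and a projection $\pi$ of $\mathbb C^n$ ($\pi^2=\pi$), the simple element is $$h_{\alpha_1,\alpha_2,\pi}(\lambda)=I+\frac{\alpha_1-\alpha_2}{\lambda-\alpha_1}(I-\pi).$$ **Theorem.** Let $u:\mathcal O_1\to sl(n)_a^\perp$ be a smooth solution of the $j$-th flow on an open set $\mathcal O_1\ni(0,0)$, $E$ its trivialization, $m$ a local reduced wave function of $u$ on $W$ with exceptional set $S$, and $h_{\alpha_1,\alpha_2,\pi}$ a simple element. Put $V_1=\mathrm{Im}\,\pi$, $V_2=\mathrm{Im}(I-\pi)$ and $\tilde V_i(x,t)=E(x,t,\alpha_i)^{-1}(V_i)$. Then there is a connected open $\mathcal O$ with $(0,0)\in\mathcal O\subset\mathcal O_1$ and $\tilde V_1(x,t)\cap\tilde V_2(x,t)=0$ for all $(x,t)\in\mathcal O$. Moreover, for every open $\mathcal O$ with $(0,0)\in\mathcal O\subset\mathcal O_1$ on which $\tilde V_1\cap\tilde V_2=0$, one has $\mathbb C^n=\tilde V_1(x,t)\oplus\tilde V_2(x,t)$ on $\mathcal O$, and the projection $\tilde\pi(x,t)$ onto $\tilde V_1(x,t)$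 along $\tilde V_2(x,t)$ is smooth on $\mathcal O$ and satisfies: (i) $\tilde u=u+(\alpha_1-\alpha_2)[a,\tilde\pi]$ is a smooth solution $\mathcal O\to sl(n)_a^\perp$ of the $j$-th flow. The function $\tilde E(x,t,\lambda)=h_{\alpha_1,\alpha_2,\pi}(\lambda)E(x,t,\lambda)h_{\alpha_1,\alpha_2,\tilde\pi(x,t)}(\lambda)^{-1}$ ($\lambda\neq\alpha_1,\alpha_2$) extends to all $\lambda\in\mathbb C$ as a trivialization of $\tilde u$, entire in $\lambda$, and $\tilde m(x,t,\lambda)=m(x,t,\lambda)h_{\alpha_1,\alpha_2,\tilde\pi(x,t)}(\lambda)^{-1}$ is a local reduced wave function of $\tilde u$ on $W$ (with trivialization $\tilde E$ and exceptional set $S\cup\{\alpha_1,\alpha_2\}$). (ii) $\tilde\pi$ is a solution on $\mathcal O$, and if $\mathcal O$ is connected the only one, of $$\begin{cases}\tilde\pi_x=-[u,\tilde\pi]-[a,\tilde\pi]\,(\alpha_2+(\alpha_1-\alpha_2)\tilde\pi),\\ \tilde\pi_t=-\sum_{k=0}^j[Q_{b,j-k}(u),\tilde\pi]\,(\alpha_2+(\alpha_1-\alpha_2)\tilde\pi)^k,\\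 \tilde\pi^2=\tilde\pi,\qquad \tilde\pi(0,0)=\pi.\end{cases}$$ -/

import Mathlib

open scoped ContDiff

noncomputable section

/-- Space-time points `(x, t)` are elements of `ℝ × ℝ`; matrices are `n × n` over `ℂ`. -/
abbrev Mat (n : ℕ) : Type := Matrix (Fin n) (Fin n) ℂ

/-- `∂f/∂x` at `z = (x, t)`, entrywise. -/
def partialX {n : ℕ} (f : ℝ × ℝ → Mat n) (z : ℝ × ℝ) : Mat n :=
  Matrix.of fun i k => deriv (fun s : ℝ => f (s, z.2) i k) z.1

/-- `∂f/∂x` exists at `z = (x, t)` and equals `D`, entrywise. -/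
def HasPartialX {n : ℕ} (f : ℝ × ℝ → Mat n) (D : Mat n) (z : ℝ × ℝ) : Prop :=
  ∀ i k, HasDerivAt (fun s : ℝ => f (s, z.2) i k) (D i k) z.1

/-- `∂f/∂t` exists at `z = (x, t)` and equals `D`, entrywise. -/
def HasPartialT {n : ℕ} (f : ℝ × ℝ → Mat n) (D : Mat n) (z : ℝ × ℝ) : Prop :=
  ∀ i k, HasDerivAt (fun s : ℝ => f (z.1, s) i k) (D i k) z.2

/-- Smoothness (`C^∞`) on `O`, entrywise. -/
def SmoothOn {n : ℕ} {X : Type*} [NormedAddCommGroup X] [NormedSpace ℝ X]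
    (f : X → Mat n) (O : Set X) : Prop :=
  ∀ i k, ContDiffOn ℝ ∞ (fun z => f z i k) O

/-- `sl(n)_a`, the centralizer of `a = diag(a_1, …, a_n)` in `sl(n, ℂ)`. -/
def slCentralizer {n : ℕ} (a : Fin n → ℂ) : Set (Mat n) :=
  {y | y.trace = 0 ∧ ⁅Matrix.diagonal a, y⁆ = 0}

/-- `sl(n)_a^⊥`, the orthogonal complement of `sl(n)_a` in `sl(n, ℂ)` for the form `tr(yz)`. -/
def slPerp {n : ℕ} (a : Fin n → ℂ) : Set (Mat n) :=
  {y | y.trace = 0 ∧ ∀ w ∈ slCentralizer a, (w * y).trace = 0}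

/-- The rays `Γ_a`: all `l` with `Re (l (a_i - a_k)) = 0` for some pair `a_i ≠ a_k`. -/
def scatteringRays {n : ℕ} (a : Fin n → ℂ) : Set ℂ :=
  {l | ∃ i k, a i ≠ a k ∧ (l * (a i - a k)).re = 0}

/-! ### The differential operators `Q_{b,k}(u)` for `b = p(a)` -/

/-- `f(X) = ∏ (X - c)` over the distinct eigenvalues `c` of `a`: the minimal polynomial of `a`. -/
def eigenPoly {n : ℕ} (a : Fin n → ℂ) : Polynomial ℂ :=
  ∏ c ∈ Finset.univ.image a, (Polynomial.X - Polynomial.C c)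

/-- Given the truncation `q = Q_0 + Q_1 X + ⋯ + Q_k X^k` of the series
`∑ Q_{a,i} X^i` (with `X = λ⁻¹`), the next coefficient `Q_{a,k+1}`.
Its entries with `a_i ≠ a_l` are determined by
`(Q_k)_x + [u, Q_k] = [Q_{k+1}, a]`; its entries with `a_i = a_l` are determined by the vanishing
of the coefficient of `X^{k+1}` in `f(∑ Q_i X^i)`, in which the contribution of `Q_{k+1}`
is `f'(a_i) (Q_{k+1})_{il}`. -/
def nextQ {n : ℕ} (a : Fin n → ℂ) (u : ℝ × ℝ → Mat n) (q : ℝ × ℝ → PowerSeries (Mat n))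
    (k : ℕ) (z : ℝ × ℝ) : Mat n :=
  Matrix.of fun i l =>
    if a i = a l then
      -(PowerSeries.coeff (k + 1) (Polynomial.aeval (q z) (eigenPoly a)) i l)
        / (eigenPoly a).derivative.eval (a i)
    else
      (partialX (fun w => PowerSeries.coeff k (q w)) z + ⁅u z, PowerSeries.coeff k (q z)⁆) i l
        / (a l - a i)

/-- The truncation `∑_{i ≤ k} Q_{a,i}(u) X^i`, starting from `Q_{a,0} = a`. -/
def truncQ {n : ℕ} (a : Fin n → ℂ) (u : ℝ × ℝ → Mat n) : ℕ → ℝ × ℝ → PowerSeries (Mat n)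
  | 0 => fun _ => PowerSeries.C (Matrix.diagonal a)
  | k + 1 => fun z =>
      truncQ a u k z + PowerSeries.monomial (k + 1) (nextQ a u (truncQ a u k) k z)

/-- `Q_{a,k}(u)`. -/
def Qa {n : ℕ} (a : Fin n → ℂ) (u : ℝ × ℝ → Mat n) (k : ℕ) (z : ℝ × ℝ) : Mat n :=
  PowerSeries.coeff k (truncQ a u k z)

/-- `Q_{b,k}(u)` for `b = p(a)`: the coefficient of `X^k` in `p(∑ Q_{a,i}(u) X^i)`. -/
def Qb {n : ℕ} (a : Fin n → ℂ) (p : Polynomial ℂ) (u : ℝ × ℝ → Mat n) (k : ℕ) (z : ℝ × ℝ) :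
    Mat n :=
  PowerSeries.coeff k (Polynomial.aeval (PowerSeries.mk fun i => Qa a u i z) p)

/-! ### Solutions, trivializations, reduced wave functions -/

/-- `u : O → sl(n)_a^⊥` is a (smooth) solution of the `j`-th flow
`u_t = (Q_{b,j}(u))_x + [u, Q_{b,j}(u)]`, where `b = p(a)`. -/
structure IsLocalSolution {n : ℕ} (a : Fin n → ℂ) (p : Polynomial ℂ) (j : ℕ) (O : Set (ℝ × ℝ))
    (u : ℝ × ℝ → Mat n) : Prop where
  smooth : SmoothOn u O
  mem_perp : ∀ z ∈ O, u z ∈ slPerp a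
  flow : ∀ z ∈ O, HasPartialT u (partialX (Qb a p u j) z + ⁅u z, Qb a p u j z⁆) z

/-- `E : O × ℂ → GL(n, ℂ)` is a trivialization of `u` normalized at `(0, 0)`:
`E_x = E (a l + u)`, `E_t = E (b l^j + Q_{b,1}(u) l^{j-1} + ⋯ + Q_{b,j}(u))`, `E(0,0,l) = I`
(note `Q_{b,0}(u) = b`). -/
structure IsTrivialization {n : ℕ} (a : Fin n → ℂ) (p : Polynomial ℂ) (j : ℕ) (O : Set (ℝ × ℝ))
    (u : ℝ × ℝ → Mat n) (E : ℝ × ℝ → ℂ → Mat n) : Prop where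
  smooth : SmoothOn (fun q : (ℝ × ℝ) × ℂ => E q.1 q.2) (O ×ˢ Set.univ)
  invertible : ∀ z ∈ O, ∀ l, IsUnit (E z l)
  eq_x : ∀ z ∈ O, ∀ l,
    HasPartialX (fun w => E w l) (E z l * (l • Matrix.diagonal a + u z)) z
  eq_t : ∀ z ∈ O, ∀ l,
    HasPartialT (fun w => E w l)
      (E z l * (l ^ j • Polynomial.aeval (Matrix.diagonal a) p
        + ∑ k ∈ Finset.Icc 1 j, l ^ (j - k) • Qb a p u k z)) z
  normalized : ∀ l, E (0, 0) l = 1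

/-- `m(z, l) ∼ ∑ c_k(z) l^{-k}` as `l → ∞` in `ℂ \ Γ`, locally uniformly in `z ∈ O`. -/
def HasExpansionAtInfty {n : ℕ} (O : Set (ℝ × ℝ)) (Γ : Set ℂ) (m : ℝ × ℝ → ℂ → Mat n)
    (c : ℕ → ℝ × ℝ → Mat n) : Prop :=
  ∀ N : ℕ, ∀ K ⊆ O, IsCompact K → ∃ C R : ℝ, ∀ z ∈ K, ∀ l ∉ Γ, R ≤ ‖l‖ → ∀ i k,
    ‖(m z l - ∑ r ∈ Finset.range (N + 1), (l ^ r)⁻¹ • c r z) i k‖ ≤ C * (‖l‖ ^ (N + 1))⁻¹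

/-- `m` is a local reduced wave function of the local solution `u` with trivialization `E`.
`W ∪ {∞}` is an open neighborhood of `∞` in the Riemann sphere on which `m` lives
(`W = ℂ` is allowed); `S` is the set of exceptional points, where `m(z, ·)` may have a pole or a
singular value. -/
structure IsReducedWaveFunction {n : ℕ} (a : Fin n → ℂ) (p : Polynomial ℂ) (j : ℕ)
    (O : Set (ℝ × ℝ)) (W S : Set ℂ) (u : ℝ × ℝ → Mat n) (E m : ℝ × ℝ → ℂ → Mat n) : Prop where
  isOpen_domain : IsOpen W
  domain_nhds_infty : Bornology.IsBounded Wᶜ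
  exceptional_bounded : Bornology.IsBounded S
  exceptional_discrete : Sᶜ ∈ Filter.codiscreteWithin (W \ scatteringRays a)
  smooth : SmoothOn (fun q : (ℝ × ℝ) × ℂ => m q.1 q.2) (O ×ˢ ((W \ scatteringRays a) \ S))
  invertible : ∀ z ∈ O, ∀ l ∈ (W \ scatteringRays a) \ S, IsUnit (m z l)
  holomorphic : ∀ z ∈ O, ∀ i k,
    DifferentiableOn ℂ (fun l => m z l i k) ((W \ scatteringRays a) \ S)
  meromorphic : ∀ z ∈ O, ∀ i k, MeromorphicOn (fun l => m z l i k) (W \ scatteringRays a)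
  expansion : ∃ c : ℕ → ℝ × ℝ → Mat n,
    (∀ r, SmoothOn (c r) O) ∧ (∀ z ∈ O, c 0 z = 1) ∧
    HasExpansionAtInfty O (scatteringRays a) m c ∧
    ∀ z ∈ O, u z = ⁅Matrix.diagonal a, c 1 z⁆
  entire : ∀ z ∈ O, ∀ i k, Differentiable ℂ (fun l => E z l i k)
  wave_eq : ∀ z ∈ O, ∀ l ∈ (W \ scatteringRays a) \ S,
    E z l = (m (0, 0) l)⁻¹
      * NormedSpace.exp ((l * (z.1 : ℂ)) • Matrix.diagonal a
          + (l ^ j * (z.2 : ℂ)) • Polynomial.aeval (Matrix.diagonal a) p)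
      * m z l

/-! ### Simple elements and the transformed projection -/

/-- The simple element `h_{α₁,α₂,π}(l) = I + (α₁ - α₂)/(l - α₁) (I - π)`. -/
def simpleElement {n : ℕ} (α₁ α₂ : ℂ) (π : Mat n) (l : ℂ) : Mat n :=
  1 + ((α₁ - α₂) / (l - α₁)) • (1 - π)

/-- `A⁻¹(Im P)`, as a preimage. -/
def pullbackRange {n : ℕ} (A P : Mat n) : Submodule ℂ (Fin n → ℂ) :=
  (LinearMap.range (Matrix.toLin' P)).comap (Matrix.toLin' A)

open Classical in
/-- The matrix of the projection onto `V₁` along `V₂`, when `ℂⁿ = V₁ ⊕ V₂`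
(and `0` otherwise). -/
def projMatrix {n : ℕ} (V₁ V₂ : Submodule ℂ (Fin n → ℂ)) : Mat n :=
  if h : IsCompl V₁ V₂ then LinearMap.toMatrix' (V₁.projection V₂ h) else 0

/-- `π̃(z)`: the projection onto `Ṽ₁(z) = E(z,α₁)⁻¹(Im π)` along
`Ṽ₂(z) = E(z,α₂)⁻¹(Im (I - π))`. -/
def dressedProj {n : ℕ} (E : ℝ × ℝ → ℂ → Mat n) (α₁ α₂ : ℂ) (π : Mat n) (z : ℝ × ℝ) : Mat n :=
  projMatrix (pullbackRange (E z α₁) π) (pullbackRange (E z α₂) (1 - π))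

/-- The first-order system for the transformed projection `σ` on `O`. -/
structure SolvesProjSystem {n : ℕ} (a : Fin n → ℂ) (p : Polynomial ℂ) (j : ℕ) (O : Set (ℝ × ℝ))
    (u : ℝ × ℝ → Mat n) (α₁ α₂ : ℂ) (π : Mat n) (σ : ℝ × ℝ → Mat n) : Prop where
  eq_x : ∀ z ∈ O, HasPartialX σ
    (-⁅u z, σ z⁆ - ⁅Matrix.diagonal a, σ z⁆ * (α₂ • (1 : Mat n) + (α₁ - α₂) • σ z)) z
  eq_t : ∀ z ∈ O, HasPartialT σ
    (-∑ k ∈ Finset.range (j + 1),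
      ⁅Qb a p u (j - k) z, σ z⁆ * (α₂ • (1 : Mat n) + (α₁ - α₂) • σ z) ^ k) z
  idem : ∀ z ∈ O, σ z * σ z = σ z
  initial : σ (0, 0) = π

end

/-! Put `τ = α₂ + (α₁ - α₂)π̃`, which is `α₁` on `Ṽ₁` and `α₂` on `Ṽ₂`. Up to the scalar `l - α₁`,
the simple element of `π̃` is `l - τ`, so dressing is the gauge transformation by a linear factor.

The projection is explicit: `π̃ = M π M⁻¹` with `M = E(α₁)⁻¹π + E(α₂)⁻¹(1 - π)` (`dressingFrame`),
and `M` is invertible exactly when `Ṽ₁ ∩ Ṽ₂ = 0`. This gives the direct sum and smoothness, and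
existence near the origin because `M = I` there. Differentiating `M` gives a Riccati equation for
`π̃` (`hasMatDeriv_conj_dressingFrame`), which for an idempotent is the stated system
(`riccati_eq_x`, `riccati_eq_t`). The difference of two solutions satisfies a linear ODE, so a
connectedness argument yields uniqueness (`SolvesProjSystem.unique`).

The possible poles of `h E h̃⁻¹` at `α₁` and `α₂` cancel because `E(αᵢ)` maps `Ṽᵢ` into `Vᵢ`. The
extension is smooth in all variables since a difference quotient is an integral of a derivative
(`exists_dressed`).

That `Ẽ` solves the linear systems of `ũ = u + [a, τ]` needs the operators `Q_{b,k}(ũ)`. With `X =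
l⁻¹`, conjugating `∑ Q_{a,k}(u) X^k` by `1 - Xτ` preserves the algebraic equation and, by the
equation for `τ_x`, turns the recursion of `u` into that of `ũ`. Since the two conditions determine
the series, the conjugate is the series of `ũ` (`Qa_gauge`). This requires that the entrywise
definition of `Q_{a,k}` satisfy both conditions in full (`Qa_recursion_aux`). Applying `p` and
comparing coefficients gives `flowSymbol_gauge`, hence `isTrivialization_dressed`. The flow for `ũ`
is then the compatibility of the two linear systems at `l = 0` (`IsTrivialization.flow`). -/

/-! ### Entrywise derivatives of matrix-valued curves -/

section MatDeriv

variable {n : ℕ}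

/-- Entrywise derivative of a matrix-valued curve. -/
def HasMatDeriv (g : ℝ → Mat n) (D : Mat n) (s : ℝ) : Prop :=
  ∀ i k, HasDerivAt (fun r => g r i k) (D i k) s

variable {f g : ℝ → Mat n} {D D' : Mat n} {s : ℝ}

lemma HasMatDeriv.const (A : Mat n) (s : ℝ) : HasMatDeriv (fun _ => A) 0 s :=
  fun i k => hasDerivAt_const s (A i k)

lemma HasMatDeriv.add (hf : HasMatDeriv f D s) (hg : HasMatDeriv g D' s) :
    HasMatDeriv (fun r => f r + g r) (D + D') s :=
  fun i k => (hf i k).add (hg i k)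

lemma HasMatDeriv.sub (hf : HasMatDeriv f D s) (hg : HasMatDeriv g D' s) :
    HasMatDeriv (fun r => f r - g r) (D - D') s :=
  fun i k => (hf i k).sub (hg i k)

lemma HasMatDeriv.smul (c : ℂ) (hf : HasMatDeriv f D s) :
    HasMatDeriv (fun r => c • f r) (c • D) s :=
  fun i k => (hf i k).const_mul c

lemma HasMatDeriv.mul (hf : HasMatDeriv f D s) (hg : HasMatDeriv g D' s) :
    HasMatDeriv (fun r => f r * g r) (D * g s + f s * D') s := by
  intro i k
  have h : HasDerivAt (fun r => ∑ l, f r i l * g r l k)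
      (∑ l, (D i l * g s l k + f s i l * D' l k)) s :=
    HasDerivAt.fun_sum fun l _ => (hf i l).mul (hg l k)
  simpa [Matrix.mul_apply, Finset.sum_add_distrib] using h

lemma HasMatDeriv.sum {ι : Type*} (t : Finset ι) {F : ι → ℝ → Mat n} {D : ι → Mat n}
    (h : ∀ i ∈ t, HasMatDeriv (F i) (D i) s) :
    HasMatDeriv (fun r => ∑ i ∈ t, F i r) (∑ i ∈ t, D i) s := by
  intro i k
  simpa [Matrix.sum_apply] using HasDerivAt.fun_sum fun l hl => h l hl i k

lemma HasMatDeriv.unique (hf : HasMatDeriv f D s) (hf' : HasMatDeriv f D' s) : D = D' := by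
  ext i k
  exact (hf i k).unique (hf' i k)

lemma HasMatDeriv.congr (hf : HasMatDeriv f D s) (h : f =ᶠ[nhds s] g) : HasMatDeriv g D s :=
  fun i k => (hf i k).congr_of_eventuallyEq (h.symm.mono fun r hr => by simp only [hr])

/-- Existence suffices: the value would be a noncommutative sum, and it is eliminated wherever such
a derivative occurs. -/
lemma HasMatDeriv.exists_pow (hf : HasMatDeriv f D s) (m : ℕ) :
    ∃ D', HasMatDeriv (fun r => f r ^ m) D' s := by
  induction m with
  | zero => exact ⟨0, by simpa using HasMatDeriv.const (1 : Mat n) s⟩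
  | succ m ih =>
    obtain ⟨D', h⟩ := ih
    exact ⟨_, by simpa only [pow_succ] using h.mul hf⟩

/-- Differentiability of the inverse is an assumption here; only its value is computed, by
differentiating `f * g = 1`. -/
lemma HasMatDeriv.eq_of_mul_eq_one (hf : HasMatDeriv f D s) (hg : HasMatDeriv g D' s)
    (h : ∀ᶠ r in nhds s, f r * g r = 1) : D' = -(g s * D * g s) := by
  have h1 := (hf.mul hg).unique ((HasMatDeriv.const (1 : Mat n) s).congr
    (h.mono fun r hr => hr.symm))
  have hgf : g s * f s = 1 := mul_eq_one_comm.mp h.self_of_nhds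
  have h2 : g s * (D * g s + f s * D') = g s * D * g s + D' := by
    rw [mul_add, ← mul_assoc, ← mul_assoc, hgf, one_mul]
  rw [h1, mul_zero] at h2
  exact eq_neg_of_add_eq_zero_right h2.symm

lemma eventually_slice_x {O : Set (ℝ × ℝ)} (hO : IsOpen O) {z : ℝ × ℝ} (hz : z ∈ O) :
    ∀ᶠ r in nhds z.1, (r, z.2) ∈ O :=
  (by fun_prop : Continuous fun r : ℝ => (r, z.2)).continuousAt.eventually (hO.mem_nhds hz)

lemma eventually_slice_t {O : Set (ℝ × ℝ)} (hO : IsOpen O) {z : ℝ × ℝ} (hz : z ∈ O) :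
    ∀ᶠ r in nhds z.2, (z.1, r) ∈ O :=
  (by fun_prop : Continuous fun r : ℝ => (z.1, r)).continuousAt.eventually (hO.mem_nhds hz)

lemma HasPartialX.partialX_eq {f : ℝ × ℝ → Mat n} {D : Mat n} {z : ℝ × ℝ}
    (h : HasPartialX f D z) : partialX f z = D := by
  ext i k
  exact (h i k).deriv

end MatDeriv

/-! ### Smooth matrix-valued maps -/

section Smooth

variable {n : ℕ} {X : Type*} [NormedAddCommGroup X] [NormedSpace ℝ X] {O : Set X}
  {f g : X → Mat n}

lemma SmoothOn.const (A : Mat n) (O : Set X) : SmoothOn (fun _ => A) O :=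
  fun _ _ => contDiffOn_const

lemma SmoothOn.add (hf : SmoothOn f O) (hg : SmoothOn g O) : SmoothOn (fun z => f z + g z) O :=
  fun i k => (hf i k).add (hg i k)

lemma SmoothOn.sub (hf : SmoothOn f O) (hg : SmoothOn g O) : SmoothOn (fun z => f z - g z) O :=
  fun i k => (hf i k).sub (hg i k)

lemma SmoothOn.smul {c : X → ℂ} (hc : ContDiffOn ℝ ∞ c O) (hf : SmoothOn f O) :
    SmoothOn (fun z => c z • f z) O :=
  fun i k => hc.mul (hf i k)

lemma SmoothOn.mul (hf : SmoothOn f O) (hg : SmoothOn g O) : SmoothOn (fun z => f z * g z) O := by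
  intro i k
  have h : ContDiffOn ℝ ∞ (fun z => ∑ l, f z i l * g z l k) O :=
    ContDiffOn.sum fun l _ => (hf i l).mul (hg l k)
  simpa [Matrix.mul_apply] using h

lemma SmoothOn.lie (hf : SmoothOn f O) (hg : SmoothOn g O) : SmoothOn (fun z => ⁅f z, g z⁆) O :=
  (hf.mul hg).sub (hg.mul hf)

lemma SmoothOn.sum {ι : Type*} (t : Finset ι) {F : ι → X → Mat n}
    (h : ∀ i ∈ t, SmoothOn (F i) O) : SmoothOn (fun z => ∑ i ∈ t, F i z) O := by
  intro i k
  simpa [Matrix.sum_apply] using ContDiffOn.sum fun l hl => h l hl i k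

lemma SmoothOn.mono {O' : Set X} (hf : SmoothOn f O) (h : O' ⊆ O) : SmoothOn f O' :=
  fun i k => (hf i k).mono h

lemma SmoothOn.congr (hf : SmoothOn f O) (h : ∀ z ∈ O, g z = f z) : SmoothOn g O :=
  fun i k => (hf i k).congr fun z hz => by simp only [h z hz]

lemma SmoothOn.comp {Y : Type*} [NormedAddCommGroup Y] [NormedSpace ℝ Y] {O' : Set Y} {φ : Y → X}
    (hf : SmoothOn f O) (hφ : ContDiff ℝ ∞ φ) (h : Set.MapsTo φ O' O) :
    SmoothOn (fun y => f (φ y)) O' :=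
  fun i k => (hf i k).comp hφ.contDiffOn h

lemma SmoothOn.det (hf : SmoothOn f O) : ContDiffOn ℝ ∞ (fun z => (f z).det) O := by
  simp only [Matrix.det_apply']
  exact ContDiffOn.sum fun σ _ => contDiffOn_const.mul (contDiffOn_prod fun i _ => hf (σ i) i)

/-- Cramer's rule: each entry of the adjugate is the determinant of a matrix with one row made
constant. -/
lemma SmoothOn.inv (hf : SmoothOn f O) (hu : ∀ z ∈ O, IsUnit (f z)) :
    SmoothOn (fun z => (f z)⁻¹) O := by
  have hadj : SmoothOn (fun z => (f z).adjugate) O := by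
    intro i k
    simp only [Matrix.adjugate_apply]
    refine SmoothOn.det fun i' k' => ?_
    by_cases h : i' = k
    · subst h
      simpa using contDiffOn_const
    · simpa [Matrix.updateRow_ne h] using hf i' k'
  have hd : ContDiffOn ℝ ∞ (fun z => (f z).det⁻¹) O :=
    hf.det.inv fun z hz => ((Matrix.isUnit_iff_isUnit_det _).mp (hu z hz)).ne_zero
  refine (SmoothOn.smul hd hadj).congr fun z _ => ?_
  rw [Matrix.inv_def, Ring.inverse_eq_inv']

lemma SmoothOn.continuousOn (hf : SmoothOn f O) : ContinuousOn f O :=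
  continuousOn_pi.mpr fun i => continuousOn_pi.mpr fun k => (hf i k).continuousOn

lemma SmoothOn.hasMatDeriv_comp {γ : ℝ → X} {γ' : X} {s : ℝ} (hf : SmoothOn f O)
    (hO : IsOpen O) (hs : γ s ∈ O) (hγ : HasDerivAt γ γ' s) :
    HasMatDeriv (fun r => f (γ r)) (Matrix.of fun i k => fderiv ℝ (fun w => f w i k) (γ s) γ') s := by
  intro i k
  have := ((hf i k).contDiffAt (hO.mem_nhds hs)).differentiableAt (by simp)
  exact this.hasFDerivAt.comp_hasDerivAt s hγ

lemma SmoothOn.fderiv_apply (hf : SmoothOn f O) (hO : IsOpen O) (v : X) :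
    SmoothOn (fun z => Matrix.of fun i k => fderiv ℝ (fun w => f w i k) z v) O := fun i k =>
  ((hf i k).fderiv_of_isOpen hO (m := ∞) (by simp)).clm_apply contDiffOn_const

variable {U : Set (ℝ × ℝ)} {F : ℝ × ℝ → Mat n}

lemma SmoothOn.hasPartialX_fderiv (hF : SmoothOn F U) (hU : IsOpen U) {z : ℝ × ℝ} (hz : z ∈ U) :
    HasPartialX F (Matrix.of fun i k => fderiv ℝ (fun w => F w i k) z (1, 0)) z :=
  hF.hasMatDeriv_comp (γ := fun s => (s, z.2)) hU hz
    ((hasDerivAt_id z.1).prodMk (hasDerivAt_const z.1 z.2))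

lemma SmoothOn.hasPartialT_fderiv (hF : SmoothOn F U) (hU : IsOpen U) {z : ℝ × ℝ} (hz : z ∈ U) :
    HasPartialT F (Matrix.of fun i k => fderiv ℝ (fun w => F w i k) z (0, 1)) z :=
  hF.hasMatDeriv_comp (γ := fun s => (z.1, s)) hU hz
    ((hasDerivAt_const z.2 z.1).prodMk (hasDerivAt_id z.2))

lemma SmoothOn.partialX (hF : SmoothOn F U) (hU : IsOpen U) : SmoothOn (partialX F) U :=
  (hF.fderiv_apply hU (1, 0)).congr fun _ hz => (hF.hasPartialX_fderiv hU hz).partialX_eq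

lemma SmoothOn.hasPartialX (hF : SmoothOn F U) (hU : IsOpen U) {z : ℝ × ℝ} (hz : z ∈ U) :
    HasPartialX F (_root_.partialX F z) z := by
  have h := hF.hasPartialX_fderiv hU hz
  rwa [h.partialX_eq]

end Smooth

/-! ### Power series with matrix coefficients -/

section Series

open PowerSeries

variable {n : ℕ}

/-- Coefficientwise derivative of a curve of power series. -/
def HasSeriesDeriv (g : ℝ → PowerSeries (Mat n)) (D : PowerSeries (Mat n)) (s : ℝ) : Prop :=
  ∀ k, HasMatDeriv (fun r => coeff k (g r)) (coeff k D) s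

lemma HasSeriesDeriv.const (A : PowerSeries (Mat n)) (s : ℝ) :
    HasSeriesDeriv (fun _ => A) 0 s :=
  fun k => by simpa using HasMatDeriv.const (coeff k A) s

lemma HasSeriesDeriv.add {f g : ℝ → PowerSeries (Mat n)} {D D' : PowerSeries (Mat n)} {s : ℝ}
    (hf : HasSeriesDeriv f D s) (hg : HasSeriesDeriv g D' s) :
    HasSeriesDeriv (fun r => f r + g r) (D + D') s :=
  fun k => by simpa using (hf k).add (hg k)

lemma HasSeriesDeriv.mul {f g : ℝ → PowerSeries (Mat n)} {D D' : PowerSeries (Mat n)} {s : ℝ}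
    (hf : HasSeriesDeriv f D s) (hg : HasSeriesDeriv g D' s) :
    HasSeriesDeriv (fun r => f r * g r) (D * g s + f s * D') s := by
  intro k
  simp only [coeff_mul, map_add, ← Finset.sum_add_distrib]
  exact HasMatDeriv.sum _ fun x _ => (hf x.1).mul (hg x.2)

lemma HasSeriesDeriv.unique {f : ℝ → PowerSeries (Mat n)} {D D' : PowerSeries (Mat n)} {s : ℝ}
    (hf : HasSeriesDeriv f D s) (hf' : HasSeriesDeriv f D' s) : D = D' := by
  ext1 k
  exact (hf k).unique (hf' k)

lemma constantCoeff_aeval (T : PowerSeries (Mat n)) (f : Polynomial ℂ) :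
    constantCoeff (Polynomial.aeval T f) = Polynomial.aeval (constantCoeff T) f := by
  induction f using Polynomial.induction_on' with
  | add f g hf hg => simp [hf, hg]
  | monomial k c => simp [Polynomial.aeval_monomial, PowerSeries.algebraMap_apply]

lemma aeval_diagonal (a : Fin n → ℂ) (f : Polynomial ℂ) :
    Polynomial.aeval (Matrix.diagonal a : Mat n) f = Matrix.diagonal fun i => f.eval (a i) := by
  induction f using Polynomial.induction_on' with
  | add f g hf hg => simp [hf, hg]
  | monomial k c =>
    simp [Polynomial.aeval_monomial, Matrix.diagonal_pow, Matrix.algebraMap_eq_diagonal]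

/-- `L` vanishes to order `m`, and its coefficient of `X^m` is the entrywise product of `B` with
the divided differences of `f` at the points `a`. -/
def IsDividedDifference (a : Fin n → ℂ) (m : ℕ) (B : Mat n) (f : Polynomial ℂ)
    (L : PowerSeries (Mat n)) : Prop :=
  (∀ i < m, coeff i L = 0) ∧ ∀ i l,
    (a i = a l → coeff m L i l = f.derivative.eval (a i) * B i l) ∧
    (a i - a l) * coeff m L i l = (f.eval (a i) - f.eval (a l)) * B i l

lemma coeff_mul_of_vanishing_left {L T : PowerSeries (Mat n)} {m : ℕ}
    (h : ∀ i < m, coeff i L = 0) :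
    (∀ i < m, coeff i (L * T) = 0) ∧ coeff m (L * T) = coeff m L * constantCoeff T := by
  constructor
  · intro i hi
    rw [coeff_mul]
    refine Finset.sum_eq_zero fun x hx => ?_
    rw [h x.1 (by have := Finset.HasAntidiagonal.mem_antidiagonal.mp hx; omega), zero_mul]
  · rw [coeff_mul, Finset.sum_eq_single (m, 0)]
    · simp
    · rintro ⟨x, y⟩ hx hne
      have hx := Finset.HasAntidiagonal.mem_antidiagonal.mp hx
      simp only at hx
      have : x < m := by
        rcases Nat.lt_or_ge x m with h | h
        · exact h
        · exact absurd (Prod.ext (by simp; omega) (by simp; omega)) hne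
      rw [h x this, zero_mul]
    · simp

lemma coeff_mul_of_vanishing_right {L T : PowerSeries (Mat n)} {m : ℕ}
    (h : ∀ i < m, coeff i L = 0) :
    (∀ i < m, coeff i (T * L) = 0) ∧ coeff m (T * L) = constantCoeff T * coeff m L := by
  constructor
  · intro i hi
    rw [coeff_mul]
    refine Finset.sum_eq_zero fun x hx => ?_
    rw [h x.2 (by have := Finset.HasAntidiagonal.mem_antidiagonal.mp hx; omega), mul_zero]
  · rw [coeff_mul, Finset.sum_eq_single (0, m)]
    · simp
    · rintro ⟨x, y⟩ hx hne
      have hx := Finset.HasAntidiagonal.mem_antidiagonal.mp hx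
      simp only at hx
      have : y < m := by
        rcases Nat.lt_or_ge y m with h | h
        · exact h
        · exact absurd (Prod.ext (by simp; omega) (by simp; omega)) hne
      rw [h y this, mul_zero]
    · simp

lemma IsDividedDifference.C {a : Fin n → ℂ} {m : ℕ} {B : Mat n} (c : ℂ) :
    IsDividedDifference a m B (Polynomial.C c) 0 := by
  simp [IsDividedDifference]

lemma IsDividedDifference.add {a : Fin n → ℂ} {m : ℕ} {B : Mat n} {f g : Polynomial ℂ}
    {L L' : PowerSeries (Mat n)} (h : IsDividedDifference a m B f L)
    (h' : IsDividedDifference a m B g L') : IsDividedDifference a m B (f + g) (L + L') := by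
  refine ⟨fun i hi => by simp [h.1 i hi, h'.1 i hi], fun i l => ⟨fun e => ?_, ?_⟩⟩
  · simp only [map_add, Matrix.add_apply, (h.2 i l).1 e, (h'.2 i l).1 e, Polynomial.eval_add]
    ring
  · simp only [map_add, Matrix.add_apply, mul_add, (h.2 i l).2, (h'.2 i l).2, Polynomial.eval_add]
    ring

/-- Common induction step for differences and derivations. Here `L₁` is the change `δT`, `L` is
`δ(f(T))`, and `L * T + S * L₁` is the Leibniz rule for `δ(f(T) T)`. In lowest order it becomes
`(fX)[x, y] = f[x, y] y + f(x)` for divided differences. -/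
lemma IsDividedDifference.mul_X {a : Fin n → ℂ} {m : ℕ} {f : Polynomial ℂ}
    {L L₁ T S : PowerSeries (Mat n)} (h₁ : ∀ i < m, coeff i L₁ = 0)
    (h : IsDividedDifference a m (coeff m L₁) f L)
    (hT : constantCoeff T = Matrix.diagonal a)
    (hS : constantCoeff S = Polynomial.aeval (Matrix.diagonal a) f) :
    IsDividedDifference a m (coeff m L₁) (f * Polynomial.X) (L * T + S * L₁) := by
  obtain ⟨e1, e2⟩ := coeff_mul_of_vanishing_left (T := T) h.1
  obtain ⟨e3, e4⟩ := coeff_mul_of_vanishing_right (T := S) h₁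
  refine ⟨fun i hi => by simp [e1 i hi, e3 i hi], fun i l => ?_⟩
  have key : coeff m (L * T + S * L₁) i l
      = coeff m L i l * a l + f.eval (a i) * coeff m L₁ i l := by
    rw [map_add, e2, e4, hT, hS, aeval_diagonal, Matrix.add_apply, Matrix.mul_diagonal,
      Matrix.diagonal_mul]
  rw [key]
  constructor
  · intro e
    rw [(h.2 i l).1 e, ← e]
    simp
    ring
  · have := (h.2 i l).2
    simp only [Polynomial.eval_mul, Polynomial.eval_X]
    linear_combination a l * this

/-- Change of `f(T)` under a perturbation of `T` of order `m`. -/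
lemma isDividedDifference_aeval_sub {a : Fin n → ℂ} {m : ℕ} {T T' : PowerSeries (Mat n)}
    (hT : constantCoeff T = Matrix.diagonal a) (hT' : constantCoeff T' = Matrix.diagonal a)
    (h : ∀ i < m, coeff i T' = coeff i T) (f : Polynomial ℂ) :
    IsDividedDifference a m (coeff m (T' - T)) f
      (Polynomial.aeval T' f - Polynomial.aeval T f) := by
  induction f using Polynomial.induction_on with
  | C c => simpa using IsDividedDifference.C c
  | add f g hf hg =>
    have := hf.add hg
    simp only [map_add]
    convert this using 1
    abel
  | monomial k c ih =>
    have h1 : ∀ i < m, coeff i (T' - T) = 0 := fun i hi => by simp [h i hi]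
    have := ih.mul_X h1 hT
      (S := Polynomial.aeval T' (Polynomial.C c * Polynomial.X ^ k))
      (by rw [constantCoeff_aeval, hT'])
    have e : Polynomial.C c * Polynomial.X ^ (k + 1)
        = (Polynomial.C c * Polynomial.X ^ k) * (Polynomial.X : Polynomial ℂ) := by ring
    rw [e, Polynomial.aeval_mul, Polynomial.aeval_mul (x := T), Polynomial.aeval_X,
      Polynomial.aeval_X]
    convert this using 1
    noncomm_ring

/-- The derivation `X ∂ + [A, ·]` applied to `f(T)`, when it maps `T` to order `m`. -/
lemma isDividedDifference_aeval_deriv {a : Fin n → ℂ} {m : ℕ} {A : PowerSeries (Mat n)}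
    {g : ℝ → PowerSeries (Mat n)} {D : PowerSeries (Mat n)} {s : ℝ} (hg : HasSeriesDeriv g D s)
    (hT : constantCoeff (g s) = Matrix.diagonal a)
    (h : ∀ i < m, coeff i (X * D + ⁅A, g s⁆) = 0) (f : Polynomial ℂ) :
    ∃ D', HasSeriesDeriv (fun r => Polynomial.aeval (g r) f) D' s ∧
      IsDividedDifference a m (coeff m (X * D + ⁅A, g s⁆)) f
        (X * D' + ⁅A, Polynomial.aeval (g s) f⁆) := by
  induction f using Polynomial.induction_on with
  | C c =>
    refine ⟨0, by simpa using HasSeriesDeriv.const _ s, ?_⟩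
    have : ⁅A, algebraMap ℂ (PowerSeries (Mat n)) c⁆ = 0 := by
      rw [Ring.lie_def, Algebra.commutes, sub_self]
    simpa [this] using IsDividedDifference.C c
  | add f₁ f₂ ih₁ ih₂ =>
    obtain ⟨D₁, h1, h1'⟩ := ih₁
    obtain ⟨D₂, h2, h2'⟩ := ih₂
    refine ⟨D₁ + D₂, by simpa using h1.add h2, ?_⟩
    convert h1'.add h2' using 1
    simp only [map_add, Ring.lie_def, mul_add, add_mul]
    abel
  | monomial k c ih =>
    obtain ⟨D', h1, h2⟩ := ih
    have e : Polynomial.C c * Polynomial.X ^ (k + 1)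
        = (Polynomial.C c * Polynomial.X ^ k) * (Polynomial.X : Polynomial ℂ) := by ring
    generalize Polynomial.C c * Polynomial.X ^ k = F at *
    rw [e]
    refine ⟨_, by simpa only [Polynomial.aeval_mul, Polynomial.aeval_X] using h1.mul hg, ?_⟩
    rw [Polynomial.aeval_mul, Polynomial.aeval_X]
    convert h2.mul_X h hT (S := Polynomial.aeval (g s) F) (by rw [constantCoeff_aeval, hT]) using 1
    generalize Polynomial.aeval (g s) F = G
    have hX : X * G * D = G * X * D := by rw [(PowerSeries.commute_X G).eq]
    simp only [Ring.lie_def, mul_add, mul_sub, add_mul, sub_mul, ← mul_assoc]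
    rw [hX]
    abel

end Series

/-! ### The series `∑ Q_{a,k}(u) X^k` -/

section Recursion

open PowerSeries

variable {n : ℕ}

lemma eval_eigenPoly (a : Fin n → ℂ) (i : Fin n) : (eigenPoly a).eval (a i) = 0 := by
  rw [eigenPoly, Polynomial.eval_prod]
  exact Finset.prod_eq_zero (Finset.mem_image_of_mem a (Finset.mem_univ i)) (by simp)

/-- The product runs over distinct eigenvalues, so its roots are simple. This justifies the division
in `nextQ`. -/
lemma eval_derivative_eigenPoly_ne_zero (a : Fin n → ℂ) (i : Fin n) :
    (eigenPoly a).derivative.eval (a i) ≠ 0 := by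
  have h : (eigenPoly a).Separable :=
    Polynomial.separable_prod_X_sub_C_iff'.mpr fun x _ y _ h => h
  have := h.eval₂_derivative_ne_zero (RingHom.id ℂ) (x := a i)
    (by simpa using eval_eigenPoly a i)
  simpa using this

lemma coeff_truncQ (a : Fin n → ℂ) (u : ℝ × ℝ → Mat n) (k i : ℕ) (z : ℝ × ℝ) :
    coeff i (truncQ a u k z) = if i ≤ k then Qa a u i z else 0 := by
  have hlow : ∀ k, ∀ i > k, coeff i (truncQ a u k z) = 0 := by
    intro k
    induction k with
    | zero => intro i hi; simp [truncQ, coeff_C, (show i ≠ 0 by omega)]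
    | succ k ih =>
      intro i hi
      simp [truncQ, ih i (by omega), coeff_monomial, (show i ≠ k + 1 by omega)]
  split_ifs with h
  · induction k with
    | zero => rw [Nat.le_zero.mp h]; rfl
    | succ k ih =>
      rcases Nat.lt_or_ge k i with h' | h'
      · rw [show i = k + 1 by omega]; rfl
      · simp [truncQ, ih h', coeff_monomial, (show i ≠ k + 1 by omega)]
  · exact hlow k i (by omega)

lemma Qa_zero (a : Fin n → ℂ) (u : ℝ × ℝ → Mat n) (z : ℝ × ℝ) :
    Qa a u 0 z = Matrix.diagonal a := by
  simp [Qa, truncQ]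

lemma Qa_succ (a : Fin n → ℂ) (u : ℝ × ℝ → Mat n) (k : ℕ) (z : ℝ × ℝ) :
    Qa a u (k + 1) z = nextQ a u (truncQ a u k) k z := by
  have := coeff_truncQ a u k (k + 1) z
  rw [if_neg (by omega)] at this
  simp [Qa, truncQ, this]

lemma constantCoeff_truncQ (a : Fin n → ℂ) (u : ℝ × ℝ → Mat n) (k : ℕ) (z : ℝ × ℝ) :
    constantCoeff (truncQ a u k z) = Matrix.diagonal a := by
  rw [← coeff_zero_eq_constantCoeff_apply, coeff_truncQ, if_pos (Nat.zero_le k), Qa_zero]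

lemma smoothOn_coeff_aeval {O : Set (ℝ × ℝ)} {T : ℝ × ℝ → PowerSeries (Mat n)}
    (h : ∀ k, SmoothOn (fun z => coeff k (T z)) O) (f : Polynomial ℂ) (k : ℕ) :
    SmoothOn (fun z => coeff k (Polynomial.aeval (T z) f)) O := by
  induction f using Polynomial.induction_on generalizing k with
  | C c => simpa using SmoothOn.const _ O
  | add f g hf hg => simpa using (hf k).add (hg k)
  | monomial m c ih =>
    have e : Polynomial.C c * Polynomial.X ^ (m + 1)
        = (Polynomial.C c * Polynomial.X ^ m) * (Polynomial.X : Polynomial ℂ) := by ring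
    rw [e]
    simp only [Polynomial.aeval_mul (q := Polynomial.X), Polynomial.aeval_X, coeff_mul]
    exact SmoothOn.sum _ fun x _ => (ih x.1).mul (h x.2)

lemma smoothOn_Qa {O : Set (ℝ × ℝ)} (hO : IsOpen O) (a : Fin n → ℂ) {u : ℝ × ℝ → Mat n}
    (hu : SmoothOn u O) (k : ℕ) : SmoothOn (Qa a u k) O := by
  induction k using Nat.strong_induction_on with
  | _ k ih =>
    cases k with
    | zero => exact (SmoothOn.const _ O).congr fun z _ => Qa_zero a u z
    | succ k =>
      have hT : ∀ i, SmoothOn (fun z => coeff i (truncQ a u k z)) O := by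
        intro i
        simp only [coeff_truncQ]
        split_ifs with h
        · exact ih i (by omega)
        · exact SmoothOn.const _ O
      have h1 := smoothOn_coeff_aeval hT (eigenPoly a) (k + 1)
      have h2 := ((hT k).partialX hO).add (hu.lie (hT k))
      refine SmoothOn.congr (f := nextQ a u (truncQ a u k) k) (fun i l => ?_)
        fun z _ => Qa_succ a u k z
      by_cases hil : a i = a l
      · simpa [nextQ, hil] using (h1 i l).neg.div_const _
      · simpa [nextQ, hil] using (h2 i l).div_const _

lemma smoothOn_Qb {O : Set (ℝ × ℝ)} (hO : IsOpen O) (a : Fin n → ℂ) (p : Polynomial ℂ)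
    {u : ℝ × ℝ → Mat n} (hu : SmoothOn u O) (k : ℕ) : SmoothOn (Qb a p u k) O :=
  smoothOn_coeff_aeval (T := fun z => PowerSeries.mk fun i => Qa a u i z)
    (fun k => by simpa using smoothOn_Qa hO a hu k) p k

lemma lie_diagonal_apply (a : Fin n → ℂ) (B : Mat n) (i l : Fin n) :
    ⁅Matrix.diagonal a, B⁆ i l = (a i - a l) * B i l := by
  rw [Ring.lie_def, Matrix.sub_apply, Matrix.diagonal_mul, Matrix.mul_diagonal]
  ring

/-- With `X = l⁻¹`, the series `C a + X * C u` is `l⁻¹(a l + u)`. The recursion for `Q_{a,k}`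
therefore says that `X ∂ₓ + [C a + X * C u, ·]` annihilates the series. -/
lemma coeff_lie_C_add_X_mul_C (A B : Mat n) (T : PowerSeries (Mat n)) (k : ℕ) :
    coeff (k + 1) ⁅C A + X * C B, T⁆ = ⁅A, coeff (k + 1) T⁆ + ⁅B, coeff k T⁆ := by
  have hX : T * (X * C B) = X * (T * C B) := by
    rw [← mul_assoc, (PowerSeries.commute_X T).eq, mul_assoc]
  simp only [Ring.lie_def, add_mul, mul_add, map_sub, map_add, coeff_C_mul, coeff_mul_C, hX,
    mul_assoc, coeff_succ_X_mul]
  abel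

lemma coeff_zero_lie_C_add_X_mul_C (A B : Mat n) (T : PowerSeries (Mat n)) :
    coeff 0 ⁅C A + X * C B, T⁆ = ⁅A, constantCoeff T⁆ := by
  simp [Ring.lie_def]

/-- The recursion and the algebraic equation of the operators `Q_{a,k}(u)` hold in full, not only
for the entries used in their definition. -/
lemma Qa_recursion_aux {O : Set (ℝ × ℝ)} (hO : IsOpen O) (a : Fin n → ℂ) {u : ℝ × ℝ → Mat n}
    (hu : SmoothOn u O) (k : ℕ) :
    (∀ i < k, ∀ z ∈ O,
      partialX (Qa a u i) z + ⁅u z, Qa a u i z⁆ + ⁅Matrix.diagonal a, Qa a u (i + 1) z⁆ = 0) ∧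
    ∀ i ≤ k, ∀ z ∈ O, coeff i (Polynomial.aeval (truncQ a u k z) (eigenPoly a)) = 0 := by
  induction k with
  | zero =>
    refine ⟨fun i hi => absurd hi (by omega), fun i hi z _ => ?_⟩
    rw [Nat.le_zero.mp hi, coeff_zero_eq_constantCoeff_apply, constantCoeff_aeval,
      constantCoeff_truncQ, aeval_diagonal]
    simp [eval_eigenPoly]
  | succ k ih =>
    obtain ⟨ih1, ih2⟩ := ih
    set f := eigenPoly a with hf
    -- Both claims come from applying the derivation `X ∂ₓ + [A, ·]`, `A = C a + X * C u`, to
    -- `f(T)`, where `T` is the truncation at order `k`, and reading off the coefficient of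
    -- `X^(k+1)`.
    have key : ∀ z ∈ O,
        (partialX (Qa a u k) z + ⁅u z, Qa a u k z⁆ + ⁅Matrix.diagonal a, Qa a u (k + 1) z⁆ = 0) ∧
        ∀ i l, a i ≠ a l → coeff (k + 1) (Polynomial.aeval (truncQ a u k z) f) i l = 0 := by
      intro z hz
      set g : ℝ → PowerSeries (Mat n) := fun s => truncQ a u k (s, z.2) with hg
      set D : PowerSeries (Mat n) :=
        PowerSeries.mk fun i => if i ≤ k then partialX (Qa a u i) z else 0 with hD
      have hgD : HasSeriesDeriv g D z.1 := by
        intro i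
        simp only [hg, hD, coeff_truncQ, coeff_mk]
        split_ifs with h
        · exact (smoothOn_Qa hO a hu i).hasPartialX hO hz
        · exact HasMatDeriv.const 0 _
      have hcoeff : ∀ i, coeff i (g z.1) = if i ≤ k then Qa a u i z else 0 :=
        fun i => coeff_truncQ a u k i z
      have hg0 : constantCoeff (g z.1) = Matrix.diagonal a := constantCoeff_truncQ a u k z
      have hlow : ∀ i < k + 1,
          coeff i (X * D + ⁅C (Matrix.diagonal a) + X * C (u z), g z.1⁆) = 0 := by
        intro i hi
        cases i with
        | zero =>
          rw [map_add, coeff_zero_lie_C_add_X_mul_C, hg0, coeff_zero_X_mul, zero_add,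
            Ring.lie_def, sub_self]
        | succ i =>
          rw [map_add, coeff_lie_C_add_X_mul_C, coeff_succ_X_mul, hcoeff, hcoeff, hD, coeff_mk,
            if_pos (by omega), if_pos (by omega), if_pos (by omega), ← ih1 i (by omega) z hz]
          abel
      -- The truncation has no term of order `k + 1`, so `[a, Q_{k+1}]` is missing here.
      have htop : coeff (k + 1) (X * D + ⁅C (Matrix.diagonal a) + X * C (u z), g z.1⁆)
          = partialX (Qa a u k) z + ⁅u z, Qa a u k z⁆ := by
        rw [map_add, coeff_lie_C_add_X_mul_C, coeff_succ_X_mul, hcoeff, hcoeff, hD, coeff_mk,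
          if_pos le_rfl, if_neg (by omega), if_pos le_rfl, Ring.lie_def, mul_zero, zero_mul,
          sub_self, zero_add]
      obtain ⟨D', hD', hdd⟩ := isDividedDifference_aeval_deriv hgD hg0 hlow f
      -- This coefficient of `f(T)` vanishes on all of `O`, so its `x`-derivative vanishes too.
      have hD'k : coeff k D' = 0 := by
        refine (hD' k).unique ((HasMatDeriv.const 0 z.1).congr ?_)
        filter_upwards [eventually_slice_x hO hz] with r hr
        exact (ih2 k le_rfl (r, z.2) hr).symm
      have hR : coeff (k + 1)
          (X * D' + ⁅C (Matrix.diagonal a) + X * C (u z), Polynomial.aeval (g z.1) f⁆)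
          = ⁅Matrix.diagonal a, coeff (k + 1) (Polynomial.aeval (g z.1) f)⁆ := by
        have h0 : coeff k (Polynomial.aeval (g z.1) f) = 0 := ih2 k le_rfl z hz
        rw [map_add, coeff_lie_C_add_X_mul_C, coeff_succ_X_mul, hD'k, h0, Ring.lie_def (u z),
          mul_zero, zero_mul, sub_self, zero_add, add_zero]
      have hdd2 := hdd.2
      rw [hR, htop] at hdd2
      have hQ : Qa a u (k + 1) z = nextQ a u (truncQ a u k) k z := Qa_succ a u k z
      have hfun : (fun w => coeff k (truncQ a u k w)) = Qa a u k := by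
        funext w
        rw [coeff_truncQ, if_pos le_rfl]
      constructor
      · ext i l
        have h1 := (hdd2 i l).1
        rw [Matrix.add_apply, lie_diagonal_apply, hQ]
        rw [lie_diagonal_apply] at h1
        -- In a block `a i = a l` the commutator with `a` vanishes, so `f'(a i)` times the entry of
        -- `(Q_k)_x + [u, Q_k]` is zero. Off the blocks the equation is the definition of `nextQ`.
        by_cases hil : a i = a l
        · have h2 := h1 hil
          rw [hil, sub_self, zero_mul, ← hil] at h2
          have h3 := (mul_eq_zero.mp h2.symm).resolve_left (eval_derivative_eigenPoly_ne_zero a i)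
          rw [h3, hil]
          simp
        · have : a l - a i ≠ 0 := sub_ne_zero.mpr (Ne.symm hil)
          simp only [nextQ, Matrix.of_apply, if_neg hil, hfun]
          rw [congrFun hfun z]
          field_simp
          simp
      · intro i l hil
        have h2 := (hdd2 i l).2
        rw [lie_diagonal_apply, hf, eval_eigenPoly, eval_eigenPoly, sub_self, zero_mul] at h2
        have : a i - a l ≠ 0 := sub_ne_zero.mpr hil
        simpa [this] using h2
    refine ⟨fun i hi z hz => ?_, fun i hi z hz => ?_⟩
    · rcases Nat.lt_or_ge i k with h | h
      · exact ih1 i h z hz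
      · rw [show i = k by omega]
        exact (key z hz).1
    -- Adding `Q_{k+1} X^(k+1)` changes the next coefficient of `f(T)` by `f'(a i)` times the entry
    -- inside a block, which `nextQ` chooses to cancel it. Off the blocks the change is zero,
    -- because `f` vanishes at both eigenvalues.
    · have hdd := isDividedDifference_aeval_sub (constantCoeff_truncQ a u k z)
        (constantCoeff_truncQ a u (k + 1) z) (m := k + 1) (fun i hi => by
          rw [coeff_truncQ, coeff_truncQ, if_pos (by omega), if_pos (by omega)]) f
      rcases Nat.lt_or_ge i (k + 1) with h | h
      · have := hdd.1 i h
        rwa [map_sub, ih2 i (by omega) z hz, sub_zero] at this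
      · rw [show i = k + 1 by omega]
        ext i l
        obtain ⟨h1, h2⟩ := hdd.2 i l
        rw [map_sub, map_sub, coeff_truncQ, coeff_truncQ, if_pos le_rfl, if_neg (by omega),
          sub_zero, Matrix.sub_apply, Qa_succ] at h1 h2
        by_cases hil : a i = a l
        · have h3 := h1 hil
          have hne := eval_derivative_eigenPoly_ne_zero a i
          simp only [nextQ, Matrix.of_apply, if_pos hil] at h3
          rw [← hf] at h3 hne
          field_simp at h3
          simpa using h3
        · rw [(key z hz).2 i l hil, hf, eval_eigenPoly, eval_eigenPoly, sub_self, zero_mul] at h2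
          have : a i - a l ≠ 0 := sub_ne_zero.mpr hil
          simpa [this] using h2

lemma Qa_recursion {O : Set (ℝ × ℝ)} (hO : IsOpen O) (a : Fin n → ℂ) {u : ℝ × ℝ → Mat n}
    (hu : SmoothOn u O) (k : ℕ) {z : ℝ × ℝ} (hz : z ∈ O) :
    partialX (Qa a u k) z + ⁅u z, Qa a u k z⁆ + ⁅Matrix.diagonal a, Qa a u (k + 1) z⁆ = 0 :=
  (Qa_recursion_aux hO a hu (k + 1)).1 k (Nat.lt_succ_self k) z hz

lemma aeval_Qa_eigenPoly {O : Set (ℝ × ℝ)} (hO : IsOpen O) (a : Fin n → ℂ) {u : ℝ × ℝ → Mat n}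
    (hu : SmoothOn u O) {z : ℝ × ℝ} (hz : z ∈ O) :
    Polynomial.aeval (PowerSeries.mk fun i => Qa a u i z) (eigenPoly a) = 0 := by
  ext1 k
  have h := (isDividedDifference_aeval_sub (constantCoeff_truncQ a u k z)
    (T' := PowerSeries.mk fun i => Qa a u i z) (m := k + 1)
    (by rw [← coeff_zero_eq_constantCoeff_apply, coeff_mk, Qa_zero])
    (fun i hi => by rw [coeff_mk, coeff_truncQ, if_pos (by omega)]) (eigenPoly a)).1 k
    (Nat.lt_succ_self k)
  rw [map_sub, (Qa_recursion_aux hO a hu k).2 k le_rfl z hz, sub_zero] at h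
  simpa using h

/-- The operators `Q_{a,k}(u)` are determined by their recursion and their algebraic equation. -/
lemma eq_Qa_of_recursion {O : Set (ℝ × ℝ)} (hO : IsOpen O) (a : Fin n → ℂ) {u : ℝ × ℝ → Mat n}
    {q : ℝ × ℝ → PowerSeries (Mat n)} (h0 : ∀ z ∈ O, constantCoeff (q z) = Matrix.diagonal a)
    (hrec : ∀ z ∈ O, ∀ k, HasPartialX (fun w => coeff k (q w))
      (-⁅u z, coeff k (q z)⁆ - ⁅Matrix.diagonal a, coeff (k + 1) (q z)⁆) z)
    (hf : ∀ z ∈ O, Polynomial.aeval (q z) (eigenPoly a) = 0) (k : ℕ) :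
    ∀ z ∈ O, coeff k (q z) = Qa a u k z := by
  induction k using Nat.strong_induction_on with
  | _ k ih =>
    intro z hz
    cases k with
    | zero => rw [coeff_zero_eq_constantCoeff_apply, h0 z hz, Qa_zero]
    | succ k =>
      have hdd := isDividedDifference_aeval_sub (constantCoeff_truncQ a u k z) (h0 z hz)
        (m := k + 1) (fun i hi => by rw [coeff_truncQ, if_pos (by omega), ih i hi z hz])
        (eigenPoly a)
      rw [hf z hz] at hdd
      -- The derivative needs equality on a whole slice around `z`, which is why the induction
      -- hypothesis is quantified over `O`.
      have hP : partialX (fun w => coeff k (truncQ a u k w)) z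
          = -⁅u z, coeff k (q z)⁆ - ⁅Matrix.diagonal a, coeff (k + 1) (q z)⁆ := by
        refine HasPartialX.partialX_eq (HasMatDeriv.congr (hrec z hz k) ?_)
        filter_upwards [eventually_slice_x hO hz] with r hr
        rw [coeff_truncQ, if_pos le_rfl]
        exact ih k (Nat.lt_succ_self k) (r, z.2) hr
      rw [Qa_succ]
      ext i l
      by_cases hil : a i = a l
      · have h1 := (hdd.2 i l).1 hil
        have hne := eval_derivative_eigenPoly_ne_zero a i
        simp only [nextQ, Matrix.of_apply, if_pos hil]
        rw [map_sub, map_sub, coeff_truncQ, if_neg (by omega)] at h1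
        rw [eq_div_iff hne]
        simp at h1
        rw [h1]
        ring
      · have hne : a l - a i ≠ 0 := sub_ne_zero.mpr (Ne.symm hil)
        simp only [nextQ, Matrix.of_apply, if_neg hil, hP]
        rw [coeff_truncQ, if_pos le_rfl, ← ih k (Nat.lt_succ_self k) z hz, eq_div_iff hne,
          Matrix.add_apply, Matrix.sub_apply, Matrix.neg_apply, lie_diagonal_apply]
        ring

end Recursion

/-! ### Gauge transformation by `l - τ` -/

section Gauge

open PowerSeries

variable {n : ℕ}

lemma one_sub_X_mul_C_mul_geom (A : Mat n) :
    (1 - X * C A) * (PowerSeries.mk fun k => A ^ k) = 1 := by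
  ext1 k
  rw [sub_mul, one_mul, map_sub, mul_assoc, coeff_mk]
  cases k with
  | zero => simp
  | succ k => rw [coeff_succ_X_mul, coeff_C_mul, coeff_mk, ← pow_succ', sub_self]; simp [coeff_one]

lemma geom_mul_one_sub_X_mul_C (A : Mat n) :
    (PowerSeries.mk fun k => A ^ k) * (1 - X * C A) = 1 := by
  ext1 k
  rw [mul_sub, mul_one, map_sub, ← mul_assoc, (PowerSeries.commute_X _).eq, mul_assoc, coeff_mk]
  cases k with
  | zero => simp
  | succ k => rw [coeff_succ_X_mul, coeff_mul_C, coeff_mk, ← pow_succ, sub_self]; simp [coeff_one]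

lemma aeval_conj {R : Type*} [Ring R] [Algebra ℂ R] {N K : R} (hNK : N * K = 1) (hKN : K * N = 1)
    (q : R) (f : Polynomial ℂ) :
    Polynomial.aeval (N * q * K) f = N * Polynomial.aeval q f * K := by
  induction f using Polynomial.induction_on with
  | C c => rw [Polynomial.aeval_C, Polynomial.aeval_C, ← Algebra.commutes, mul_assoc, hNK, mul_one]
  | add f g hf hg => rw [map_add, map_add, hf, hg, mul_add, add_mul]
  | monomial k c ih =>
    have e : Polynomial.C c * Polynomial.X ^ (k + 1)
        = (Polynomial.C c * Polynomial.X ^ k) * (Polynomial.X : Polynomial ℂ) := by ring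
    rw [e, Polynomial.aeval_mul, Polynomial.aeval_X, Polynomial.aeval_mul (x := q),
      Polynomial.aeval_X, ih]
    calc _ = N * Polynomial.aeval q (Polynomial.C c * Polynomial.X ^ k) * (K * N) * q * K := by
          simp only [mul_assoc]
      _ = _ := by rw [hKN, mul_one]; simp only [mul_assoc]

/-- Here `x` plays the role of `X`, `K` is the inverse of the gauge `N`, and `D` is the derivative
of `N q K`. Hypothesis `hD` is the derivative of `(N q K) N = N q`, so the derivative of `K` is
never needed; `N` is cancelled at the end. -/
lemma gauge_derivation_eq_zero {R : Type*} [Ring R] {x A A' N N' K q q' D : R}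
    (hx : ∀ B, x * B = B * x) (hNK : N * K = 1) (hKN : K * N = 1)
    (hN : x * N' = N * A - A' * N) (hq : x * q' = -⁅A, q⁆)
    (hD : D * N + N * q * K * N' = N' * q + N * q') : x * D + ⁅A', N * q * K⁆ = 0 := by
  have h1 : N * q * K * N = N * q := by rw [mul_assoc _ K, hKN, mul_one]
  have h2 : x * (D * N) = x * N' * q + N * (x * q') - N * q * K * (x * N') := by
    rw [eq_sub_of_add_eq hD, mul_sub, mul_add, ← mul_assoc x N, hx N, ← mul_assoc x (N * q * K),
      hx (N * q * K)]
    simp only [mul_assoc]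
  have h3 : (x * D + ⁅A', N * q * K⁆) * N = 0 := by
    have h4 : (A' * (N * q * K) - N * q * K * A') * N
        = A' * (N * q) - N * q * K * (A' * N) := by
      rw [sub_mul, mul_assoc A', h1, mul_assoc _ A']
    have h5 : N * q * K * (N * A - A' * N) = N * q * A - N * q * K * (A' * N) := by
      rw [mul_sub, ← mul_assoc, h1]
    rw [add_mul, mul_assoc x, h2, hN, hq, h5, Ring.lie_def, Ring.lie_def, h4]
    generalize N * q * K * (A' * N) = G
    noncomm_ring
  calc _ = (x * D + ⁅A', N * q * K⁆) * N * K := by rw [mul_assoc _ N, hNK, mul_one]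
    _ = 0 := by rw [h3, zero_mul]

/-- The dressed series solves the recursion of the dressed potential. -/
lemma Qa_gauge {O : Set (ℝ × ℝ)} (hO : IsOpen O) (a : Fin n → ℂ) {u τ : ℝ × ℝ → Mat n}
    (hu : SmoothOn u O)
    (hτ : ∀ z ∈ O, HasPartialX τ (-⁅u z, τ z⁆ - ⁅Matrix.diagonal a, τ z⁆ * τ z) z)
    {z : ℝ × ℝ} (hz : z ∈ O) :
    (PowerSeries.mk fun k => Qa a (fun w => u w + ⁅Matrix.diagonal a, τ w⁆) k z)
      = (1 - X * C (τ z)) * (PowerSeries.mk fun k => Qa a u k z)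
        * (PowerSeries.mk fun k => τ z ^ k) := by
  set q : ℝ × ℝ → PowerSeries (Mat n) := fun w => PowerSeries.mk fun k => Qa a u k w with hq
  set N : ℝ × ℝ → PowerSeries (Mat n) := fun w => 1 - X * C (τ w) with hN
  set K : ℝ × ℝ → PowerSeries (Mat n) := fun w => PowerSeries.mk fun k => τ w ^ k with hK
  have hNK : ∀ w, N w * K w = 1 := fun w => one_sub_X_mul_C_mul_geom (τ w)
  have hKN : ∀ w, K w * N w = 1 := fun w => geom_mul_one_sub_X_mul_C (τ w)
  have hq0 : ∀ w, constantCoeff (q w) = Matrix.diagonal a := fun w => by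
    rw [← coeff_zero_eq_constantCoeff_apply, hq, coeff_mk, Qa_zero]
  -- By uniqueness it suffices to check the constant term, the recursion for the new potential, and
  -- the algebraic equation, the last being invariant under conjugation.
  have main := eq_Qa_of_recursion hO a (u := fun w => u w + ⁅Matrix.diagonal a, τ w⁆)
    (q := fun w => N w * q w * K w) (fun w _ => ?_) (fun w hw => ?_) (fun w hw => ?_)
  · ext1 k
    rw [coeff_mk]
    exact (main k z hz).symm
  · have h1 : constantCoeff (K w) = 1 := by
      rw [← coeff_zero_eq_constantCoeff_apply, hK, coeff_mk, pow_zero]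
    have h2 : constantCoeff (N w) = 1 := by simp [hN]
    rw [map_mul, map_mul, h1, h2, hq0, one_mul, mul_one]
  · set A : PowerSeries (Mat n) := C (Matrix.diagonal a) + X * C (u w) with hA
    set A' : PowerSeries (Mat n) :=
      C (Matrix.diagonal a) + X * C (u w + ⁅Matrix.diagonal a, τ w⁆) with hA'
    set T : Mat n := -⁅u w, τ w⁆ - ⁅Matrix.diagonal a, τ w⁆ * τ w with hT
    have dN : HasSeriesDeriv (fun s => N (s, w.2)) (-(X * C T)) w.1 := by
      intro k
      cases k with
      | zero =>
        simpa [hN] using HasMatDeriv.const (n := n) 1 w.1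
      | succ k =>
        have : HasMatDeriv (fun s => coeff k (C (τ (s, w.2)))) (coeff k (C T)) w.1 := by
          simp only [coeff_C]
          split_ifs
          · exact hτ w hw
          · exact HasMatDeriv.const 0 _
        simpa only [hN, map_sub, map_neg, coeff_succ_X_mul, zero_sub] using
          (HasMatDeriv.const (coeff (k + 1) (1 : PowerSeries (Mat n))) w.1).sub this
    obtain ⟨DK, dK⟩ : ∃ DK, HasSeriesDeriv (fun s => K (s, w.2)) DK w.1 := by
      choose DK h using fun k => HasMatDeriv.exists_pow (f := fun s => τ (s, w.2)) (hτ w hw) k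
      exact ⟨PowerSeries.mk DK, fun k => by simpa [hK] using h k⟩
    have dq : HasSeriesDeriv (fun s => q (s, w.2))
        (PowerSeries.mk fun k => partialX (Qa a u k) w) w.1 := fun k => by
      simp only [hq, coeff_mk]
      exact (smoothOn_Qa hO a hu k).hasPartialX hO hw
    have dqe : X * (PowerSeries.mk fun k => partialX (Qa a u k) w) = -⁅A, q w⁆ := by
      ext1 k
      cases k with
      | zero =>
        rw [map_neg, coeff_zero_lie_C_add_X_mul_C, hq0, coeff_zero_X_mul, Ring.lie_def, sub_self,
          neg_zero]
      | succ k =>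
        rw [map_neg, coeff_lie_C_add_X_mul_C, coeff_succ_X_mul, hq, coeff_mk, coeff_mk, coeff_mk,
          eq_neg_iff_add_eq_zero, ← Qa_recursion hO a hu k hw]
        abel
    -- The coefficient of `X` cancels because the new potential is `u + [a, τ]`; the coefficient of
    -- `X²` is the hypothesis on `τ_x`.
    have dNe : X * -(X * C T) = N w * A - A' * N w := by
      have hX : ∀ B : PowerSeries (Mat n), B * X = X * B := fun B => (PowerSeries.commute_X B).eq
      have hX' : ∀ B B' : PowerSeries (Mat n), B * (X * B') = X * (B * B') := fun B B' => by
        rw [← mul_assoc, hX, mul_assoc]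
      simp only [hN, hA, hA', hT, Ring.lie_def, map_add, map_sub, map_neg, map_mul, mul_add,
        mul_sub, add_mul, sub_mul, one_mul, mul_one, mul_neg, mul_assoc, hX']
      abel
    obtain ⟨D, dq'⟩ : ∃ D, HasSeriesDeriv (fun s => N (s, w.2) * q (s, w.2) * K (s, w.2)) D w.1 :=
      ⟨_, (dN.mul dq).mul dK⟩
    have e1 : (fun s => N (s, w.2) * q (s, w.2) * K (s, w.2) * N (s, w.2))
        = fun s => N (s, w.2) * q (s, w.2) := by
      funext s
      rw [mul_assoc _ (K _), hKN, mul_one]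
    have e2 : D * N w + N w * q w * K w * -(X * C T)
        = -(X * C T) * q w + N w * (PowerSeries.mk fun k => partialX (Qa a u k) w) := by
      have d1 := dN.mul dq
      have d2 := dq'.mul dN
      rw [e1] at d2
      exact d2.unique d1
    have e4 : X * D + ⁅A', N w * q w * K w⁆ = 0 :=
      gauge_derivation_eq_zero (fun B => (PowerSeries.commute_X B).eq.symm) (hNK w) (hKN w) dNe dqe
        e2
    intro k
    have h := congrArg (coeff (k + 1)) e4
    rw [map_add, coeff_succ_X_mul, hA', coeff_lie_C_add_X_mul_C, map_zero] at h
    have h' : coeff k D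
        = -⁅u w + ⁅Matrix.diagonal a, τ w⁆, coeff k (N w * q w * K w)⁆
          - ⁅Matrix.diagonal a, coeff (k + 1) (N w * q w * K w)⁆ := by
      rw [eq_neg_of_add_eq_zero_left h]
      abel
    rw [← h']
    exact dq' k
  · rw [aeval_conj (hNK w) (hKN w), aeval_Qa_eigenPoly hO a hu hw, mul_zero, zero_mul]

lemma Qb_zero (a : Fin n → ℂ) (p : Polynomial ℂ) (u : ℝ × ℝ → Mat n) (z : ℝ × ℝ) :
    Qb a p u 0 z = Polynomial.aeval (Matrix.diagonal a) p := by
  rw [Qb, coeff_zero_eq_constantCoeff_apply, constantCoeff_aeval,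
    ← coeff_zero_eq_constantCoeff_apply, coeff_mk, Qa_zero]

/-- Conjugation commutes with `p`, so `1 - Xτ` intertwines the two series for `b`; the identity is
the coefficient of `X^(k+1)`. -/
lemma Qb_gauge {O : Set (ℝ × ℝ)} (hO : IsOpen O) (a : Fin n → ℂ) (p : Polynomial ℂ)
    {u τ : ℝ × ℝ → Mat n} (hu : SmoothOn u O)
    (hτ : ∀ z ∈ O, HasPartialX τ (-⁅u z, τ z⁆ - ⁅Matrix.diagonal a, τ z⁆ * τ z) z)
    {z : ℝ × ℝ} (hz : z ∈ O) (k : ℕ) :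
    Qb a p (fun w => u w + ⁅Matrix.diagonal a, τ w⁆) (k + 1) z - Qb a p u (k + 1) z
      = Qb a p (fun w => u w + ⁅Matrix.diagonal a, τ w⁆) k z * τ z - τ z * Qb a p u k z := by
  have h : Polynomial.aeval
      (PowerSeries.mk fun k => Qa a (fun w => u w + ⁅Matrix.diagonal a, τ w⁆) k z) p
        * (1 - X * C (τ z))
      = (1 - X * C (τ z)) * Polynomial.aeval (PowerSeries.mk fun k => Qa a u k z) p := by
    rw [Qa_gauge hO a hu hτ hz, aeval_conj (one_sub_X_mul_C_mul_geom _)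
      (geom_mul_one_sub_X_mul_C _), mul_assoc, geom_mul_one_sub_X_mul_C, mul_one]
  have h' := congrArg (coeff (k + 1)) h
  rw [mul_sub, sub_mul, one_mul, mul_one, ← mul_assoc, (PowerSeries.commute_X _).eq, mul_assoc,
    mul_assoc, map_sub, map_sub, coeff_succ_X_mul, coeff_succ_X_mul, coeff_mul_C,
    coeff_C_mul] at h'
  rw [sub_eq_sub_iff_add_eq_add] at h' ⊢
  rw [add_comm _ (Qb a p u (k + 1) z)]
  exact h'

/-- The symbol `b l^j + Q_{b,1}(u) l^{j-1} + ⋯ + Q_{b,j}(u)` of the `j`-th flow. -/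
noncomputable def flowSymbol (a : Fin n → ℂ) (p : Polynomial ℂ) (j : ℕ) (u : ℝ × ℝ → Mat n)
    (z : ℝ × ℝ) (l : ℂ) : Mat n :=
  ∑ k ∈ Finset.range (j + 1), l ^ (j - k) • Qb a p u k z

lemma flowSymbol_eq (a : Fin n → ℂ) (p : Polynomial ℂ) (j : ℕ) (u : ℝ × ℝ → Mat n)
    (z : ℝ × ℝ) (l : ℂ) :
    l ^ j • Polynomial.aeval (Matrix.diagonal a) p
        + ∑ k ∈ Finset.Icc 1 j, l ^ (j - k) • Qb a p u k z = flowSymbol a p j u z l := by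
  rw [flowSymbol, Finset.range_eq_Ico, Finset.sum_eq_sum_Ico_succ_bot (Nat.succ_pos j), Qb_zero]
  rfl

lemma flowSymbol_succ (a : Fin n → ℂ) (p : Polynomial ℂ) (j : ℕ) (u : ℝ × ℝ → Mat n)
    (z : ℝ × ℝ) (l : ℂ) :
    flowSymbol a p (j + 1) u z l = l • flowSymbol a p j u z l + Qb a p u (j + 1) z := by
  rw [flowSymbol, Finset.sum_range_succ, flowSymbol, Finset.smul_sum, Nat.sub_self, pow_zero,
    one_smul]
  congr 1
  refine Finset.sum_congr rfl fun k hk => ?_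
  rw [smul_smul, ← pow_succ', Nat.succ_sub (Nat.lt_succ_iff.mp (Finset.mem_range.mp hk))]

lemma flowSymbol_zero_right (a : Fin n → ℂ) (p : Polynomial ℂ) (j : ℕ) (u : ℝ × ℝ → Mat n)
    (z : ℝ × ℝ) : flowSymbol a p j u z 0 = Qb a p u j z := by
  cases j with
  | zero => simp [flowSymbol]
  | succ j => rw [flowSymbol_succ, zero_smul, zero_add]

lemma smoothOn_flowSymbol {O : Set (ℝ × ℝ)} (hO : IsOpen O) (a : Fin n → ℂ) (p : Polynomial ℂ)
    (j : ℕ) {u : ℝ × ℝ → Mat n} (hu : SmoothOn u O) (l : ℂ) :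
    SmoothOn (fun z => flowSymbol a p j u z l) O :=
  SmoothOn.sum _ fun k _ => SmoothOn.smul contDiffOn_const (smoothOn_Qb hO a p hu k)

/-- Commuting `l - τ` past the symbols of the flow. -/
lemma flowSymbol_gauge {O : Set (ℝ × ℝ)} (hO : IsOpen O) (a : Fin n → ℂ) (p : Polynomial ℂ)
    (j : ℕ) {u τ : ℝ × ℝ → Mat n} (hu : SmoothOn u O)
    (hτ : ∀ z ∈ O, HasPartialX τ (-⁅u z, τ z⁆ - ⁅Matrix.diagonal a, τ z⁆ * τ z) z)
    {z : ℝ × ℝ} (hz : z ∈ O) (l : ℂ) :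
    (l • 1 - τ z) * flowSymbol a p j u z l
      - flowSymbol a p j (fun w => u w + ⁅Matrix.diagonal a, τ w⁆) z l * (l • 1 - τ z)
      = ∑ k ∈ Finset.range (j + 1), ⁅Qb a p u (j - k) z, τ z⁆ * τ z ^ k := by
  have hg := fun k => Qb_gauge hO a p hu hτ hz k
  set u' := fun w => u w + ⁅Matrix.diagonal a, τ w⁆
  -- Horner's scheme `flowSymbol_succ` makes the left side telescope, leaving a difference
  -- independent of `l`.
  have h1 : (l • 1 - τ z) * flowSymbol a p j u z l - flowSymbol a p j u' z l * (l • 1 - τ z)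
      = Qb a p u' (j + 1) z - Qb a p u (j + 1) z := by
    induction j with
    | zero =>
      rw [hg]
      simp only [flowSymbol, zero_add, Finset.sum_range_one, Nat.sub_self, pow_zero, one_smul, Qb_zero,
        sub_mul, mul_sub, smul_mul_assoc, mul_smul_comm, one_mul, mul_one]
      abel
    | succ j ih =>
      have h2 : (l • 1 - τ z) * flowSymbol a p (j + 1) u z l
          - flowSymbol a p (j + 1) u' z l * (l • 1 - τ z)
          = l • ((l • 1 - τ z) * flowSymbol a p j u z l - flowSymbol a p j u' z l * (l • 1 - τ z))
            + ((l • 1 - τ z) * Qb a p u (j + 1) z - Qb a p u' (j + 1) z * (l • 1 - τ z)) := by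
        simp only [flowSymbol_succ, mul_add, add_mul, mul_smul_comm, smul_mul_assoc, smul_sub]
        abel
      rw [h2, ih, hg (j + 1)]
      simp only [sub_mul, mul_sub, smul_mul_assoc, mul_smul_comm, one_mul, mul_one, smul_sub]
      abel
  rw [h1]
  clear h1
  -- Each step uses `Q'_{k+1} - Q_{k+1} = Q'_k τ - τ Q_k = (Q'_k - Q_k) τ + [Q_k, τ]`, with primes
  -- for the new potential.
  induction j with
  | zero =>
    rw [hg]
    simp [Qb_zero, Ring.lie_def]
  | succ j ih =>
    rw [hg, Finset.sum_range_succ', pow_zero, mul_one, Nat.sub_zero]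
    have h3 : ∑ k ∈ Finset.range (j + 1), ⁅Qb a p u (j + 1 - (k + 1)) z, τ z⁆ * τ z ^ (k + 1)
        = (∑ k ∈ Finset.range (j + 1), ⁅Qb a p u (j - k) z, τ z⁆ * τ z ^ k) * τ z := by
      rw [Finset.sum_mul]
      refine Finset.sum_congr rfl fun k _ => ?_
      rw [Nat.add_sub_add_right, pow_succ, mul_assoc]
    rw [h3, ← ih, Ring.lie_def, sub_mul]
    abel

end Gauge

/-! ### The transformed projection -/

section Projection

variable {n : ℕ}

lemma mem_pullbackRange {A P : Mat n} (hP : P * P = P) {v : Fin n → ℂ} :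
    v ∈ pullbackRange A P ↔ P.mulVec (A.mulVec v) = A.mulVec v := by
  simp only [pullbackRange, Submodule.mem_comap, LinearMap.mem_range, Matrix.toLin'_apply]
  constructor
  · rintro ⟨w, hw⟩
    rw [← hw, Matrix.mulVec_mulVec, hP]
  · intro h
    exact ⟨_, h⟩

/-- Maps `Im π` onto `A₁⁻¹(Im π)` and `Im (1 - π)` onto `A₂⁻¹(Im (1 - π))`. -/
noncomputable def dressingFrame (A₁ A₂ π : Mat n) : Mat n := A₁⁻¹ * π + A₂⁻¹ * (1 - π)

lemma one_sub_mul_self_of_idem {π : Mat n} (hπ : π * π = π) : (1 - π) * (1 - π) = 1 - π := by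
  simp [mul_sub, sub_mul, hπ]

lemma mul_one_sub_of_idem {π : Mat n} (hπ : π * π = π) : π * (1 - π) = 0 := by
  rw [mul_sub, hπ, mul_one, sub_self]

lemma one_sub_mul_of_idem {π : Mat n} (hπ : π * π = π) : (1 - π) * π = 0 := by
  rw [sub_mul, hπ, one_mul, sub_self]

variable {A₁ A₂ π : Mat n}

lemma dressingFrame_mul_proj (hπ : π * π = π) : dressingFrame A₁ A₂ π * π = A₁⁻¹ * π := by
  rw [dressingFrame, add_mul, mul_assoc, hπ, mul_assoc, one_sub_mul_of_idem hπ, mul_zero, add_zero]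

lemma dressingFrame_mul_one_sub (hπ : π * π = π) :
    dressingFrame A₁ A₂ π * (1 - π) = A₂⁻¹ * (1 - π) := by
  rw [dressingFrame, add_mul, mul_assoc, mul_one_sub_of_idem hπ, mul_assoc,
    one_sub_mul_self_of_idem hπ, mul_zero, zero_add]

lemma isUnit_of_mulVec_eq_zero {M : Mat n} (h : ∀ v, M.mulVec v = 0 → v = 0) : IsUnit M := by
  rw [← Matrix.mulVec_injective_iff_isUnit]
  intro v w hvw
  exact sub_eq_zero.mp (h _ (by rw [Matrix.mulVec_sub]; exact sub_eq_zero.mpr hvw))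

lemma inv_mul_proj_mulVec_mem (hA : IsUnit A₁) (hπ : π * π = π) (v : Fin n → ℂ) :
    (A₁⁻¹ * π).mulVec v ∈ pullbackRange A₁ π := by
  have : A₁ * (A₁⁻¹ * π) = π := by
    rw [← mul_assoc, Matrix.mul_nonsing_inv _ ((Matrix.isUnit_iff_isUnit_det _).mp hA), one_mul]
  rw [mem_pullbackRange hπ, Matrix.mulVec_mulVec v A₁, this, Matrix.mulVec_mulVec, hπ]

lemma eq_zero_of_inv_mul_mulVec_eq_zero {P : Mat n} (hA : IsUnit A₁) {v : Fin n → ℂ}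
    (h : (A₁⁻¹ * P).mulVec v = 0) : P.mulVec v = 0 := by
  have := congrArg A₁.mulVec h
  rwa [Matrix.mulVec_mulVec, ← mul_assoc,
    Matrix.mul_nonsing_inv _ ((Matrix.isUnit_iff_isUnit_det _).mp hA), one_mul,
    Matrix.mulVec_zero] at this

/-- If `v` is in the kernel, then `A₁⁻¹πv = -A₂⁻¹(1 - π)v` lies in both subspaces, hence is zero,
and so are `πv` and `(1 - π)v`. -/
lemma isUnit_dressingFrame (h₁ : IsUnit A₁) (h₂ : IsUnit A₂) (hπ : π * π = π)
    (h : pullbackRange A₁ π ⊓ pullbackRange A₂ (1 - π) = ⊥) : IsUnit (dressingFrame A₁ A₂ π) := by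
  refine isUnit_of_mulVec_eq_zero fun v hv => ?_
  rw [dressingFrame, Matrix.add_mulVec] at hv
  have m₁ := inv_mul_proj_mulVec_mem h₁ hπ v
  have m₂ := inv_mul_proj_mulVec_mem h₂ (one_sub_mul_self_of_idem hπ) v
  have hmem : (A₁⁻¹ * π).mulVec v ∈ pullbackRange A₁ π ⊓ pullbackRange A₂ (1 - π) :=
    ⟨m₁, by rw [eq_neg_of_add_eq_zero_left hv]; exact neg_mem m₂⟩
  rw [h, Submodule.mem_bot] at hmem
  rw [hmem, zero_add] at hv
  have e₁ := eq_zero_of_inv_mul_mulVec_eq_zero h₁ hmem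
  have e₂ := eq_zero_of_inv_mul_mulVec_eq_zero h₂ hv
  rw [Matrix.sub_mulVec, e₁, Matrix.one_mulVec, sub_zero] at e₂
  exact e₂

/-- For `v` in both subspaces the frame sends `A₁v` and `A₂v` to `v`. Injectivity gives `A₁v = A₂v`,
a vector of `Im π ∩ Im (1 - π) = 0`. -/
lemma pullbackRange_inf_eq_bot (h₁ : IsUnit A₁) (h₂ : IsUnit A₂) (hπ : π * π = π)
    (h : IsUnit (dressingFrame A₁ A₂ π)) :
    pullbackRange A₁ π ⊓ pullbackRange A₂ (1 - π) = ⊥ := by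
  rw [eq_bot_iff]
  rintro v ⟨m₁, m₂⟩
  rw [SetLike.mem_coe, mem_pullbackRange hπ] at m₁
  rw [SetLike.mem_coe, mem_pullbackRange (one_sub_mul_self_of_idem hπ)] at m₂
  have i₁ := Matrix.nonsing_inv_mul _ ((Matrix.isUnit_iff_isUnit_det _).mp h₁)
  have i₂ := Matrix.nonsing_inv_mul _ ((Matrix.isUnit_iff_isUnit_det _).mp h₂)
  have e₁ : (dressingFrame A₁ A₂ π).mulVec (A₁.mulVec v) = v := by
    rw [← m₁, Matrix.mulVec_mulVec, dressingFrame_mul_proj hπ, ← Matrix.mulVec_mulVec, m₁,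
      Matrix.mulVec_mulVec, i₁, Matrix.one_mulVec]
  have e₂ : (dressingFrame A₁ A₂ π).mulVec (A₂.mulVec v) = v := by
    rw [← m₂, Matrix.mulVec_mulVec, dressingFrame_mul_one_sub hπ, ← Matrix.mulVec_mulVec, m₂,
      Matrix.mulVec_mulVec, i₂, Matrix.one_mulVec]
  have e : A₁.mulVec v = A₂.mulVec v :=
    Matrix.mulVec_injective_iff_isUnit.mpr h (e₁.trans e₂.symm)
  have : A₁.mulVec v = 0 := by
    rw [← m₁, e, ← m₂, Matrix.mulVec_mulVec, mul_one_sub_of_idem hπ, Matrix.zero_mulVec]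
  rw [Submodule.mem_bot, ← Matrix.one_mulVec v, ← i₁, ← Matrix.mulVec_mulVec, this,
    Matrix.mulVec_zero]

lemma isCompl_pullbackRange (h₁ : IsUnit A₁) (h₂ : IsUnit A₂) (hπ : π * π = π)
    (h : pullbackRange A₁ π ⊓ pullbackRange A₂ (1 - π) = ⊥) :
    IsCompl (pullbackRange A₁ π) (pullbackRange A₂ (1 - π)) := by
  refine ⟨disjoint_iff.mpr h, codisjoint_iff.mpr (eq_top_iff.mpr fun v _ => ?_)⟩
  have hM := (Matrix.isUnit_iff_isUnit_det _).mp (isUnit_dressingFrame h₁ h₂ hπ h)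
  have e : v = (A₁⁻¹ * π).mulVec ((dressingFrame A₁ A₂ π)⁻¹.mulVec v)
      + (A₂⁻¹ * (1 - π)).mulVec ((dressingFrame A₁ A₂ π)⁻¹.mulVec v) := by
    rw [← Matrix.add_mulVec, Matrix.mulVec_mulVec, ← dressingFrame, Matrix.mul_nonsing_inv _ hM,
      Matrix.one_mulVec]
  rw [e]
  exact Submodule.add_mem_sup (inv_mul_proj_mulVec_mem h₁ hπ _)
    (inv_mul_proj_mulVec_mem h₂ (one_sub_mul_self_of_idem hπ) _)

/-- The frame carries the splitting `Im π ⊕ Im (1 - π)` to the pulled-back one, so it conjugates one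
projection into the other. -/
lemma projMatrix_pullbackRange (h₁ : IsUnit A₁) (h₂ : IsUnit A₂) (hπ : π * π = π)
    (h : pullbackRange A₁ π ⊓ pullbackRange A₂ (1 - π) = ⊥) :
    projMatrix (pullbackRange A₁ π) (pullbackRange A₂ (1 - π))
      = dressingFrame A₁ A₂ π * π * (dressingFrame A₁ A₂ π)⁻¹ := by
  have hc := isCompl_pullbackRange h₁ h₂ hπ h
  have hM := (Matrix.isUnit_iff_isUnit_det _).mp (isUnit_dressingFrame h₁ h₂ hπ h)
  rw [projMatrix, dif_pos hc]
  apply Matrix.toLin'.injective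
  rw [Matrix.toLin'_toMatrix']
  refine LinearMap.ext fun v => ?_
  obtain ⟨w, rfl⟩ : ∃ w, v = (dressingFrame A₁ A₂ π).mulVec w :=
    ⟨(dressingFrame A₁ A₂ π)⁻¹.mulVec v, by
      rw [Matrix.mulVec_mulVec, Matrix.mul_nonsing_inv _ hM, Matrix.one_mulVec]⟩
  rw [Matrix.toLin'_apply, Matrix.mulVec_mulVec, mul_assoc, Matrix.nonsing_inv_mul _ hM, mul_one,
    dressingFrame_mul_proj hπ, dressingFrame, Matrix.add_mulVec, map_add]
  have e₁ := Submodule.projection_apply_of_mem_left hc (inv_mul_proj_mulVec_mem h₁ hπ w)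
  have e₂ := Submodule.projection_apply_of_mem_right hc
    (inv_mul_proj_mulVec_mem h₂ (one_sub_mul_self_of_idem hπ) w)
  rw [e₁, e₂, add_zero]

section Conj

variable {M : Mat n}

lemma conj_idem (hM : IsUnit M) (hπ : π * π = π) :
    M * π * M⁻¹ * (M * π * M⁻¹) = M * π * M⁻¹ := by
  have := Matrix.nonsing_inv_mul _ ((Matrix.isUnit_iff_isUnit_det _).mp hM)
  calc _ = M * π * (M⁻¹ * M) * π * M⁻¹ := by simp only [mul_assoc]
    _ = _ := by rw [this, mul_one, mul_assoc M, hπ]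

lemma one_sub_conj (hM : IsUnit M) : 1 - M * π * M⁻¹ = M * (1 - π) * M⁻¹ := by
  rw [mul_sub, sub_mul, mul_one, Matrix.mul_nonsing_inv _ ((Matrix.isUnit_iff_isUnit_det _).mp hM)]

/-- With `B` the inverse frame, this and the next lemma are the conditions that cancel the poles of
the dressed trivialization at `α₁` and `α₂`. -/
lemma one_sub_mul_mul_conj_dressingFrame (h₁ : IsUnit A₁) (hπ : π * π = π) (B : Mat n) :
    (1 - π) * A₁ * (dressingFrame A₁ A₂ π * π * B) = 0 := by
  have := Matrix.mul_nonsing_inv _ ((Matrix.isUnit_iff_isUnit_det _).mp h₁)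
  rw [dressingFrame_mul_proj hπ]
  calc _ = (1 - π) * (A₁ * A₁⁻¹) * π * B := by simp only [mul_assoc]
    _ = 0 := by rw [this, mul_one, one_sub_mul_of_idem hπ, zero_mul]

lemma mul_mul_conj_dressingFrame (h₂ : IsUnit A₂) (hπ : π * π = π) (B : Mat n) :
    π * A₂ * (dressingFrame A₁ A₂ π * (1 - π) * B) = 0 := by
  have := Matrix.mul_nonsing_inv _ ((Matrix.isUnit_iff_isUnit_det _).mp h₂)
  rw [dressingFrame_mul_one_sub hπ]
  calc _ = π * (A₂ * A₂⁻¹) * (1 - π) * B := by simp only [mul_assoc]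
    _ = 0 := by rw [this, mul_one, mul_one_sub_of_idem hπ, zero_mul]

end Conj

/-- The Riccati equation of the transformed projection along a curve. -/
lemma hasMatDeriv_conj_dressingFrame {A₁ A₂ : ℝ → Mat n} {G₁ G₂ D₁ D₂ D : Mat n} {s : ℝ}
    (hπ : π * π = π)
    (hA₁ : HasMatDeriv A₁ (A₁ s * G₁) s) (hA₂ : HasMatDeriv A₂ (A₂ s * G₂) s)
    (hI₁ : HasMatDeriv (fun r => (A₁ r)⁻¹) D₁ s) (hI₂ : HasMatDeriv (fun r => (A₂ r)⁻¹) D₂ s)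
    (hM : HasMatDeriv (fun r => (dressingFrame (A₁ r) (A₂ r) π)⁻¹) D s)
    (hu₁ : ∀ᶠ r in nhds s, IsUnit (A₁ r)) (hu₂ : ∀ᶠ r in nhds s, IsUnit (A₂ r))
    (hu : ∀ᶠ r in nhds s, IsUnit (dressingFrame (A₁ r) (A₂ r) π))
    {σ : Mat n} (hσ : σ = dressingFrame (A₁ s) (A₂ s) π * π * (dressingFrame (A₁ s) (A₂ s) π)⁻¹) :
    HasMatDeriv
      (fun r => dressingFrame (A₁ r) (A₂ r) π * π * (dressingFrame (A₁ r) (A₂ r) π)⁻¹)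
      (-(G₁ * σ) + σ * G₁ * σ + σ * G₂ * (1 - σ)) s := by
  have inv_eq : ∀ A : Mat n, IsUnit A → A * A⁻¹ = 1 := fun A hA =>
    Matrix.mul_nonsing_inv _ ((Matrix.isUnit_iff_isUnit_det _).mp hA)
  have inv_eq' : ∀ A : Mat n, IsUnit A → A⁻¹ * A = 1 := fun A hA =>
    Matrix.nonsing_inv_mul _ ((Matrix.isUnit_iff_isUnit_det _).mp hA)
  have e₁ : D₁ = -(G₁ * (A₁ s)⁻¹) := by
    rw [hA₁.eq_of_mul_eq_one hI₁ (hu₁.mono fun r hr => inv_eq _ hr), ← mul_assoc,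
      inv_eq' _ hu₁.self_of_nhds, one_mul]
  have e₂ : D₂ = -(G₂ * (A₂ s)⁻¹) := by
    rw [hA₂.eq_of_mul_eq_one hI₂ (hu₂.mono fun r hr => inv_eq _ hr), ← mul_assoc,
      inv_eq' _ hu₂.self_of_nhds, one_mul]
  subst e₁ e₂
  set M : ℝ → Mat n := fun r => dressingFrame (A₁ r) (A₂ r) π with hMdef
  have hMu : IsUnit (M s) := hu.self_of_nhds
  have hσ' : 1 - σ = M s * (1 - π) * (M s)⁻¹ := by rw [hσ, one_sub_conj hMu]
  have hM₁ : (A₁ s)⁻¹ * π = σ * M s := by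
    rw [hσ, mul_assoc, inv_eq' _ hMu, mul_one, dressingFrame_mul_proj hπ]
  have hM₂ : (A₂ s)⁻¹ * (1 - π) = (1 - σ) * M s := by
    rw [hσ', mul_assoc, inv_eq' _ hMu, mul_one, dressingFrame_mul_one_sub hπ]
  -- The inverses satisfy `(Aᵢ⁻¹)' = -Gᵢ Aᵢ⁻¹`, and `A₁⁻¹π = σM`, `A₂⁻¹(1 - π) = (1 - σ)M` express
  -- the result through `σ` and `M`.
  have dM : HasMatDeriv M (-((G₁ * σ + G₂ * (1 - σ)) * M s)) s := by
    have h := (hI₁.mul (HasMatDeriv.const π s)).add (hI₂.mul (HasMatDeriv.const (1 - π) s))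
    change HasMatDeriv (fun r => (A₁ r)⁻¹ * π + (A₂ r)⁻¹ * (1 - π)) _ s
    convert h using 1
    rw [mul_zero, mul_zero, add_zero, add_zero, neg_mul, neg_mul, mul_assoc, mul_assoc, hM₁, hM₂]
    noncomm_ring
  have eD : D = (M s)⁻¹ * (G₁ * σ + G₂ * (1 - σ)) := by
    rw [dM.eq_of_mul_eq_one hM (hu.mono fun r hr => inv_eq _ hr), mul_neg, neg_mul, neg_neg,
      ← mul_assoc, mul_assoc, inv_eq _ hMu, mul_one]
  have h := (dM.mul (HasMatDeriv.const π s)).mul hM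
  have hσσ : σ * σ = σ := by rw [hσ]; exact conj_idem hMu hπ
  convert h using 1
  have t₁ : -((G₁ * σ + G₂ * (1 - σ)) * M s) * π * (M s)⁻¹ = -((G₁ * σ + G₂ * (1 - σ)) * σ) := by
    conv_rhs => rw [hσ]
    simp only [mul_assoc, neg_mul, hMdef, hσ]
  have t₂ : M s * π * ((M s)⁻¹ * (G₁ * σ + G₂ * (1 - σ))) = σ * (G₁ * σ + G₂ * (1 - σ)) := by
    rw [← mul_assoc, ← hσ]
  rw [mul_zero, add_zero, eD, t₂, t₁, add_mul, mul_assoc G₁, hσσ, mul_assoc G₂,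
    one_sub_mul_of_idem hσσ]
  noncomm_ring

/-! ### From the Riccati equation to the stated first-order system -/

section System

variable {σ : Mat n}

/-- The matrix acts as `α₁` on `Im σ` and as `α₂` on `ker σ`. -/
lemma pow_of_idem (hσ : σ * σ = σ) (α₁ α₂ : ℂ) (k : ℕ) :
    (α₂ • (1 : Mat n) + (α₁ - α₂) • σ) ^ k = α₁ ^ k • σ + α₂ ^ k • (1 - σ) := by
  induction k with
  | zero => simp
  | succ k ih =>
    rw [pow_succ, ih]
    simp only [add_mul, mul_add, smul_mul_assoc, mul_smul_comm, mul_one, sub_mul, one_mul, hσ,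
      sub_self, add_zero, smul_sub, smul_smul]
    module

lemma lie_mul_pow_of_idem (hσ : σ * σ = σ) (α₁ α₂ : ℂ) (B : Mat n) (k : ℕ) :
    ⁅B, σ⁆ * (α₂ • (1 : Mat n) + (α₁ - α₂) • σ) ^ k
      = α₁ ^ k • (B * σ - σ * B * σ) - α₂ ^ k • (σ * B * (1 - σ)) := by
  have h1 : ⁅B, σ⁆ * σ = B * σ - σ * B * σ := by rw [Ring.lie_def, sub_mul, mul_assoc B, hσ]
  have h2 : ⁅B, σ⁆ * (1 - σ) = -(σ * B * (1 - σ)) := by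
    rw [Ring.lie_def, sub_mul, mul_assoc B, mul_one_sub_of_idem hσ, mul_zero, zero_sub]
  rw [pow_of_idem hσ, mul_add, mul_smul_comm, mul_smul_comm, h1, h2, smul_neg, ← sub_eq_add_neg]

lemma riccati_eq_x (hσ : σ * σ = σ) (α₁ α₂ : ℂ) (A B : Mat n) :
    -((α₁ • A + B) * σ) + σ * (α₁ • A + B) * σ + σ * (α₂ • A + B) * (1 - σ)
      = -⁅B, σ⁆ - ⁅A, σ⁆ * (α₂ • (1 : Mat n) + (α₁ - α₂) • σ) := by
  have h := lie_mul_pow_of_idem hσ α₁ α₂ A 1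
  rw [pow_one, pow_one, pow_one] at h
  rw [h, Ring.lie_def]
  simp only [mul_add, add_mul, mul_sub, mul_one, smul_mul_assoc, mul_smul_comm]
  module

lemma riccati_eq_t (hσ : σ * σ = σ) (α₁ α₂ : ℂ) (j : ℕ) (P : ℕ → Mat n) :
    -((∑ k ∈ Finset.range (j + 1), α₁ ^ (j - k) • P k) * σ)
        + σ * (∑ k ∈ Finset.range (j + 1), α₁ ^ (j - k) • P k) * σ
        + σ * (∑ k ∈ Finset.range (j + 1), α₂ ^ (j - k) • P k) * (1 - σ)
      = -∑ k ∈ Finset.range (j + 1),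
          ⁅P (j - k), σ⁆ * (α₂ • (1 : Mat n) + (α₁ - α₂) • σ) ^ k := by
  have h : ∑ k ∈ Finset.range (j + 1), ⁅P (j - k), σ⁆ * (α₂ • (1 : Mat n) + (α₁ - α₂) • σ) ^ k
      = ∑ k ∈ Finset.range (j + 1), (α₁ ^ (j - k) • (P k * σ - σ * P k * σ)
          - α₂ ^ (j - k) • (σ * P k * (1 - σ))) := by
    -- The symbol pairs `P k` with the power `j - k`, the system pairs `P (j - k)` with the power
    -- `k`.
    rw [← Finset.sum_range_reflect]
    refine Finset.sum_congr rfl fun k hk => ?_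
    have hk' := Finset.mem_range.mp hk
    rw [show j + 1 - 1 - k = j - k by omega, show j - (j - k) = k by omega,
      lie_mul_pow_of_idem hσ]
  rw [h]
  simp only [Finset.sum_sub_distrib, smul_sub, Finset.mul_sum, Finset.sum_mul, smul_mul_assoc,
    mul_smul_comm]
  abel

end System

end Projection

/-! ### Division by a linear factor with smooth dependence on parameters -/

section Division

open Set

/-- Differentiation under the integral; the dominating constant bounds the partial derivative on the
compact set `closedBall x ε × [0, 1]`. -/
lemma hasFDerivAt_parametric_integral {H V : Type*} [NormedAddCommGroup H] [NormedSpace ℝ H]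
    [ProperSpace H] [NormedAddCommGroup V] [NormedSpace ℝ V] {U : Set H} (hU : IsOpen U)
    {F : H × ℝ → V} (hF : ContDiffOn ℝ ∞ F (U ×ˢ univ)) {x : H} (hx : x ∈ U) :
    HasFDerivAt (fun y => ∫ s in (0 : ℝ)..1, F (y, s))
      (∫ s in (0 : ℝ)..1, (fderiv ℝ F (x, s)).comp (ContinuousLinearMap.inl ℝ H ℝ)) x := by
  have hUo : IsOpen (U ×ˢ (univ : Set ℝ)) := hU.prod isOpen_univ
  obtain ⟨ε, hε, hball⟩ := Metric.nhds_basis_closedBall.mem_iff.mp (hU.mem_nhds hx)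
  have hcont : ContinuousOn
      (fun q : H × ℝ => (fderiv ℝ F q).comp (ContinuousLinearMap.inl ℝ H ℝ)) (U ×ˢ univ) :=
    (hF.continuousOn_fderiv_of_isOpen hUo (by simp)).clm_comp continuousOn_const
  obtain ⟨B, hB⟩ := ((isCompact_closedBall x ε).prod (isCompact_Icc (a := (0 : ℝ)) (b := 1)))
    |>.exists_bound_of_continuousOn
      (hcont.mono (prod_mono hball (subset_univ _)))
  have hslice : ∀ y ∈ U, Continuous fun s : ℝ => F (y, s) := fun y hy =>
    hF.continuousOn.comp_continuous (by fun_prop) fun s => ⟨hy, mem_univ _⟩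
  have hslice' : Continuous fun s : ℝ =>
      (fderiv ℝ F (x, s)).comp (ContinuousLinearMap.inl ℝ H ℝ) :=
    hcont.comp_continuous (by fun_prop) fun s => ⟨hx, mem_univ _⟩
  refine intervalIntegral.hasFDerivAt_integral_of_dominated_of_fderiv_le
    (F' := fun y s => (fderiv ℝ F (y, s)).comp (ContinuousLinearMap.inl ℝ H ℝ))
    (bound := fun _ => B) (Metric.closedBall_mem_nhds x hε) ?_
    ((hslice x hx).intervalIntegrable _ _) hslice'.aestronglyMeasurable ?_
    (by simp) ?_
  · filter_upwards [hU.mem_nhds hx] with y hy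
    exact (hslice y hy).aestronglyMeasurable
  · refine Filter.Eventually.of_forall fun s hs y hy => hB (y, s) ⟨hy, ?_⟩
    rw [uIoc_of_le zero_le_one] at hs
    exact ⟨hs.1.le, hs.2⟩
  · refine Filter.Eventually.of_forall fun s _ y hy => ?_
    have h := ((hF.contDiffAt (hUo.mem_nhds (x := (y, s)) ⟨hball hy, mem_univ s⟩)).differentiableAt
      (by simp)).hasFDerivAt
    exact h.comp y (hasFDerivAt_prodMk_left y s)

/-- Induction on the order of differentiability. The target `V` is generalized because the
derivative is again a parametric integral, with values in `H →L[ℝ] V`. -/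
lemma contDiffOn_parametric_integral {H : Type} [NormedAddCommGroup H] [NormedSpace ℝ H]
    [ProperSpace H] {U : Set H} (hU : IsOpen U) (m : ℕ) {V : Type} [NormedAddCommGroup V]
    [NormedSpace ℝ V] {F : H × ℝ → V} (hF : ContDiffOn ℝ ∞ F (U ×ˢ univ)) :
    ContDiffOn ℝ m (fun y => ∫ s in (0 : ℝ)..1, F (y, s)) U := by
  induction m generalizing V with
  | zero =>
    exact contDiffOn_zero.mpr fun x hx =>
      (hasFDerivAt_parametric_integral hU hF hx).continuousAt.continuousWithinAt
  | succ m ih =>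
    have hd : ContDiffOn ℝ ∞
        (fun q : H × ℝ => (fderiv ℝ F q).comp (ContinuousLinearMap.inl ℝ H ℝ)) (U ×ˢ univ) :=
      (hF.fderiv_of_isOpen (hU.prod isOpen_univ) (by simp)).clm_comp contDiffOn_const
    push_cast
    rw [contDiffOn_succ_iff_fderiv_of_isOpen hU]
    refine ⟨fun x hx =>
      (hasFDerivAt_parametric_integral hU hF hx).differentiableAt.differentiableWithinAt,
      by simp, (ih hd).congr fun x hx => (hasFDerivAt_parametric_integral hU hF hx).fderiv⟩

variable {O : Set (ℝ × ℝ)} {F : (ℝ × ℝ) × ℂ → ℂ}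

/-- The complex derivative is the real derivative in the direction `1`; in that form it is visibly
smooth in all variables. -/
lemma deriv_eq_fderiv_apply (hO : IsOpen O) (hF : ContDiffOn ℝ ∞ F (O ×ˢ univ)) {z : ℝ × ℝ}
    (hz : z ∈ O) (hd : Differentiable ℂ fun l => F (z, l)) (l : ℂ) :
    deriv (fun l => F (z, l)) l = fderiv ℝ F (z, l) (0, 1) := by
  have h1 : HasDerivAt (fun s : ℝ => F (z, l + s)) (deriv (fun l => F (z, l)) l) 0 := by
    have hl : HasDerivAt (fun l => F (z, l)) (deriv (fun l => F (z, l)) l) (l + ((0 : ℝ) : ℂ)) := by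
      simpa using (hd l).hasDerivAt
    have h2 : HasDerivAt (fun s : ℝ => l + (s : ℂ)) 1 0 :=
      (Complex.ofRealCLM.hasDerivAt (x := (0 : ℝ))).const_add l
    simpa [Function.comp_def] using HasDerivAt.scomp (0 : ℝ) hl h2
  have h2 : HasDerivAt (fun s : ℝ => F (z, l + s)) (fderiv ℝ F (z, l) (0, 1)) 0 := by
    have hdF : HasFDerivAt F (fderiv ℝ F (z, l)) (z, l + ((0 : ℝ) : ℂ)) := by
      simpa using ((hF.contDiffAt ((hO.prod isOpen_univ).mem_nhds
        ⟨hz, mem_univ l⟩)).differentiableAt (by simp)).hasFDerivAt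
    have h3 : HasDerivAt (fun s : ℝ => (z, l + (s : ℂ))) ((0 : ℝ × ℝ), (1 : ℂ)) 0 :=
      (hasDerivAt_const (0 : ℝ) z).prodMk
        ((Complex.ofRealCLM.hasDerivAt (x := (0 : ℝ))).const_add l)
    exact hdF.comp_hasDerivAt (0 : ℝ) h3
  exact h1.unique h2

/-- The fundamental theorem of calculus on the segment from `α` to `l`. The formula has no
singularity at `l = α`. -/
lemma dslope_eq_integral {f : ℂ → ℂ} (hf : Differentiable ℂ f) (α l : ℂ) :
    dslope f α l = ∫ s in (0 : ℝ)..1, deriv f (α + s * (l - α)) := by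
  by_cases h : l = α
  · subst h
    simp
  · have hne : l - α ≠ 0 := sub_ne_zero.mpr h
    have hd : Differentiable ℂ (deriv f) := hf.deriv
    have hc : Continuous fun s : ℝ => deriv f (α + s * (l - α)) := by
      have := hd.continuous
      fun_prop
    have hderiv : ∀ s ∈ uIcc (0 : ℝ) 1,
        HasDerivAt (fun s : ℝ => f (α + s * (l - α))) ((l - α) * deriv f (α + s * (l - α))) s := by
      intro s _
      have h2 : HasDerivAt (fun s : ℝ => α + (s : ℂ) * (l - α)) (l - α) s := by
        simpa using ((Complex.ofRealCLM.hasDerivAt (x := s)).mul_const (l - α)).const_add α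
      simpa [Function.comp_def] using HasDerivAt.scomp s (hf (α + s * (l - α))).hasDerivAt h2
    have := intervalIntegral.integral_eq_sub_of_hasDerivAt hderiv
      ((continuous_const.mul hc).intervalIntegrable _ _)
    rw [intervalIntegral.integral_const_mul] at this
    rw [dslope_of_ne _ h, slope_def_field, div_eq_iff hne, mul_comm, this]
    simp

/-- The difference quotient in the last variable of a smooth map, entire in that variable, is
smooth in all variables. -/
lemma contDiffOn_dslope (hO : IsOpen O) (hF : ContDiffOn ℝ ∞ F (O ×ˢ univ))
    (hd : ∀ z ∈ O, Differentiable ℂ fun l => F (z, l)) (α : ℂ) :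
    ContDiffOn ℝ ∞ (fun q : (ℝ × ℝ) × ℂ => dslope (fun l => F (q.1, l)) α q.2) (O ×ˢ univ) := by
  have hUo : IsOpen (O ×ˢ (univ : Set ℂ)) := hO.prod isOpen_univ
  have hG : ContDiffOn ℝ ∞ (fun q => fderiv ℝ F q (0, 1)) (O ×ˢ univ) :=
    (hF.fderiv_of_isOpen hUo (by simp)).clm_apply contDiffOn_const
  have hcomp : ContDiffOn ℝ ∞ (fun q : ((ℝ × ℝ) × ℂ) × ℝ =>
      fderiv ℝ F (q.1.1, α + (q.2 : ℂ) * (q.1.2 - α)) (0, 1)) ((O ×ˢ univ) ×ˢ univ) := by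
    refine hG.comp (t := O ×ˢ univ)
      (f := fun q : ((ℝ × ℝ) × ℂ) × ℝ => (q.1.1, α + (q.2 : ℂ) * (q.1.2 - α)))
      (ContDiff.contDiffOn ?_) fun q hq => ⟨hq.1.1, mem_univ _⟩
    have : ContDiff ℝ ∞ fun q : ((ℝ × ℝ) × ℂ) × ℝ => (q.2 : ℂ) :=
      Complex.ofRealCLM.contDiff.comp contDiff_snd
    fun_prop
  refine (contDiffOn_infty.mpr fun m => contDiffOn_parametric_integral hUo m hcomp).congr ?_
  rintro ⟨z, l⟩ ⟨hz, -⟩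
  simp only
  rw [dslope_eq_integral (hd z hz)]
  refine intervalIntegral.integral_congr fun s _ => ?_
  exact deriv_eq_fderiv_apply hO hF hz (hd z hz) _

lemma differentiable_dslope {f : ℂ → ℂ} (hf : Differentiable ℂ f) (α : ℂ) :
    Differentiable ℂ (dslope f α) :=
  differentiableOn_univ.mp
    ((Complex.differentiableOn_dslope Filter.univ_mem).mpr hf.differentiableOn)

end Division

/-! ### The dressed trivialization -/

section Dressing

open Set

variable {n : ℕ}

/-- Clearing the pole leaves `l - τ`, the form used in every gauge computation. At `l = α₁` division
by zero would make the simple element `1`, hence the hypothesis. -/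
lemma smul_simpleElement (α₁ α₂ : ℂ) (π : Mat n) {l : ℂ} (hl : l ≠ α₁) :
    (l - α₁) • simpleElement α₁ α₂ π l = l • 1 - (α₂ • 1 + (α₁ - α₂) • π) := by
  have : l - α₁ ≠ 0 := sub_ne_zero.mpr hl
  rw [simpleElement, smul_add, smul_smul, mul_div_cancel₀ _ this]
  module

/-- On `Im π` the factors are `l - α₁` and `l - α₂`; on `ker π` they are exchanged. -/
lemma sub_mul_sub_conjugate (α₁ α₂ : ℂ) {π : Mat n} (hπ : π * π = π) (l : ℂ) :
    (l • 1 - (α₂ • 1 + (α₁ - α₂) • π)) * ((l - α₁) • 1 + (α₁ - α₂) • π)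
      = ((l - α₁) * (l - α₂)) • (1 : Mat n) := by
  simp only [mul_add, sub_mul, add_mul, smul_mul_assoc, mul_smul_comm, one_mul, mul_one, hπ]
  module

lemma isUnit_sub_of_idem {α₁ α₂ : ℂ} {π : Mat n} (hπ : π * π = π) {l : ℂ} (h₁ : l ≠ α₁)
    (h₂ : l ≠ α₂) : IsUnit (l • 1 - (α₂ • 1 + (α₁ - α₂) • π)) := by
  have hne : (l - α₁) * (l - α₂) ≠ 0 := mul_ne_zero (sub_ne_zero.mpr h₁) (sub_ne_zero.mpr h₂)
  refine IsUnit.of_mul_eq_one (((l - α₁) * (l - α₂))⁻¹ • ((l - α₁) • 1 + (α₁ - α₂) • π)) ?_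
  rw [mul_smul_comm, sub_mul_sub_conjugate _ _ hπ, smul_smul, inv_mul_cancel₀ hne, one_smul]

lemma simpleElement_mul_eq_one (α₁ α₂ : ℂ) {π : Mat n} (hπ : π * π = π) {l : ℂ} (h₁ : l ≠ α₁)
    (h₂ : l ≠ α₂) :
    simpleElement α₁ α₂ π l * ((l - α₂)⁻¹ • ((l - α₁) • 1 + (α₁ - α₂) • π)) = 1 := by
  have e₁ : l - α₁ ≠ 0 := sub_ne_zero.mpr h₁
  have e₂ : l - α₂ ≠ 0 := sub_ne_zero.mpr h₂
  have h : simpleElement α₁ α₂ π l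
      = (l - α₁)⁻¹ • (l • 1 - (α₂ • 1 + (α₁ - α₂) • π)) := by
    rw [← smul_simpleElement _ _ _ h₁, smul_smul, inv_mul_cancel₀ e₁, one_smul]
  rw [h, mul_smul_comm, smul_mul_assoc, sub_mul_sub_conjugate _ _ hπ, smul_smul, smul_smul]
  rw [show (l - α₂)⁻¹ * (l - α₁)⁻¹ * ((l - α₁) * (l - α₂)) = 1 by field_simp, one_smul]

lemma simpleElement_inv (α₁ α₂ : ℂ) {π : Mat n} (hπ : π * π = π) {l : ℂ} (h₁ : l ≠ α₁)
    (h₂ : l ≠ α₂) :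
    (simpleElement α₁ α₂ π l)⁻¹ = (l - α₂)⁻¹ • ((l - α₁) • 1 + (α₁ - α₂) • π) :=
  Matrix.inv_eq_right_inv (simpleElement_mul_eq_one α₁ α₂ hπ h₁ h₂)

lemma isUnit_simpleElement {α₁ α₂ : ℂ} {π : Mat n} (hπ : π * π = π) {l : ℂ} (h₁ : l ≠ α₁)
    (h₂ : l ≠ α₂) : IsUnit (simpleElement α₁ α₂ π l) :=
  IsUnit.of_mul_eq_one _ (simpleElement_mul_eq_one α₁ α₂ hπ h₁ h₂)

lemma simpleElement_mul_mul_inv {α₁ α₂ : ℂ} {σ : Mat n} (π A : Mat n) (hσ : σ * σ = σ) {l : ℂ}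
    (h₁ : l ≠ α₁) (h₂ : l ≠ α₂) :
    simpleElement α₁ α₂ π l * A * (simpleElement α₁ α₂ σ l)⁻¹
      = ((l - α₁)⁻¹ * (l - α₂)⁻¹) •
        ((l • 1 - (α₂ • 1 + (α₁ - α₂) • π)) * A * ((l - α₁) • 1 + (α₁ - α₂) • σ)) := by
  have e₁ : l - α₁ ≠ 0 := sub_ne_zero.mpr h₁
  rw [simpleElement_inv _ _ hσ h₁ h₂, ← smul_simpleElement _ _ _ h₁]
  simp only [mul_smul_comm, smul_mul_assoc, smul_smul]
  congr 1
  field_simp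

lemma simpleElement_of_eq (α : ℂ) (π : Mat n) (l : ℂ) : simpleElement α α π l = 1 := by
  simp [simpleElement]

variable {O : Set (ℝ × ℝ)} {E : ℝ × ℝ → ℂ → Mat n} {α₁ α₂ : ℂ} {π : Mat n} {σ : ℝ × ℝ → Mat n}

/-- The dressed trivialization has removable singularities at `α₁` and `α₂`. -/
lemma exists_dressed (hO : IsOpen O)
    (hE : SmoothOn (fun q : (ℝ × ℝ) × ℂ => E q.1 q.2) (O ×ˢ univ))
    (hent : ∀ z ∈ O, ∀ i k, Differentiable ℂ fun l => E z l i k)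
    (hσ : SmoothOn σ O) (hσσ : ∀ z ∈ O, σ z * σ z = σ z)
    (hr₁ : ∀ z ∈ O, (1 - π) * E z α₁ * σ z = 0)
    (hr₂ : ∀ z ∈ O, π * E z α₂ * (1 - σ z) = 0) :
    ∃ E' : ℝ × ℝ → ℂ → Mat n,
      (∀ z ∈ O, ∀ l, l ≠ α₁ → l ≠ α₂ → E' z l = simpleElement α₁ α₂ π l * E z l
        * (simpleElement α₁ α₂ (σ z) l)⁻¹) ∧
      SmoothOn (fun q : (ℝ × ℝ) × ℂ => E' q.1 q.2) (O ×ˢ univ) ∧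
      ∀ z ∈ O, ∀ i k, Differentiable ℂ fun l => E' z l i k := by
  -- When the points coincide the simple elements are trivial. Otherwise the argument divides once
  -- at each of two distinct zeros.
  by_cases hα : α₁ = α₂
  · subst hα
    exact ⟨E, fun z _ l _ _ => by simp [simpleElement_of_eq], hE, hent⟩
  -- The numerator of `h E h̃⁻¹` over `(l - α₁)(l - α₂)`; it is zero at both points.
  set F : ℝ × ℝ → ℂ → Mat n := fun z l =>
    (l • 1 - (α₂ • 1 + (α₁ - α₂) • π)) * E z l * ((l - α₁) • 1 + (α₁ - α₂) • σ z) with hF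
  have hsnd : ContDiff ℝ ∞ fun q : (ℝ × ℝ) × ℂ => q.2 := contDiff_snd
  have hFs : SmoothOn (fun q : (ℝ × ℝ) × ℂ => F q.1 q.2) (O ×ˢ univ) := by
    have hσ' : SmoothOn (fun q : (ℝ × ℝ) × ℂ => σ q.1) (O ×ˢ univ) :=
      hσ.comp contDiff_fst fun q hq => hq.1
    refine SmoothOn.mul (SmoothOn.mul (SmoothOn.sub (SmoothOn.smul hsnd.contDiffOn
      (SmoothOn.const _ _)) (SmoothOn.const _ _)) hE) (SmoothOn.add (SmoothOn.smul ?_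
      (SmoothOn.const _ _)) (SmoothOn.smul contDiffOn_const hσ'))
    exact hsnd.contDiffOn.sub contDiffOn_const
  have hFd : ∀ z ∈ O, ∀ i k, Differentiable ℂ fun l => F z l i k := by
    intro z hz i k
    have := hent z hz
    simp only [hF, Matrix.mul_apply, Matrix.sub_apply, Matrix.add_apply, Matrix.smul_apply]
    fun_prop
  have hF₁ : ∀ z ∈ O, F z α₁ = 0 := by
    intro z hz
    have : α₁ • 1 - (α₂ • 1 + (α₁ - α₂) • π) = (α₁ - α₂) • (1 - π) := by module
    simp only [hF, this, sub_self, zero_smul, zero_add, smul_mul_assoc, mul_smul_comm, hr₁ z hz,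
      smul_zero]
  have hF₂ : ∀ z ∈ O, F z α₂ = 0 := by
    intro z hz
    have e₁ : α₂ • 1 - (α₂ • 1 + (α₁ - α₂) • π) = -((α₁ - α₂) • π) := by module
    have e₂ : (α₂ - α₁) • 1 + (α₁ - α₂) • σ z = -((α₁ - α₂) • (1 - σ z)) := by module
    simp only [hF, e₁, e₂, neg_mul, mul_neg, smul_mul_assoc, mul_smul_comm, hr₂ z hz, smul_zero,
      neg_zero]
  set G : ℝ × ℝ → ℂ → Mat n := fun z l =>
    Matrix.of fun i k => dslope (fun l => F z l i k) α₁ l with hG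
  have hGs : ∀ i k, ContDiffOn ℝ ∞ (fun q : (ℝ × ℝ) × ℂ => G q.1 q.2 i k) (O ×ˢ univ) :=
    fun i k => contDiffOn_dslope (F := fun q => F q.1 q.2 i k) hO (hFs i k)
      (fun z hz => hFd z hz i k) α₁
  have hGd : ∀ z ∈ O, ∀ i k, Differentiable ℂ fun l => G z l i k :=
    fun z hz i k => differentiable_dslope (hFd z hz i k) α₁
  have hGv : ∀ z ∈ O, ∀ l ≠ α₁, ∀ i k, G z l i k = (l - α₁)⁻¹ * F z l i k := by
    intro z hz l hl i k
    simp only [hG, Matrix.of_apply]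
    rw [dslope_of_ne _ hl, slope_def_field, hF₁ z hz, Matrix.zero_apply, sub_zero, div_eq_inv_mul]
  refine ⟨fun z l => Matrix.of fun i k => dslope (fun l => G z l i k) α₂ l, ?_, fun i k =>
    contDiffOn_dslope (F := fun q => G q.1 q.2 i k) hO (hGs i k) (fun z hz => hGd z hz i k) α₂,
    fun z hz i k => differentiable_dslope (hGd z hz i k) α₂⟩
  intro z hz l h₁ h₂
  rw [simpleElement_mul_mul_inv π _ (hσσ z hz) h₁ h₂]
  ext i k
  change dslope (fun l => G z l i k) α₂ l = _
  -- After the first division `G` still vanishes at `α₂ ≠ α₁`, so the second difference quotient is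
  -- again plain division.
  rw [dslope_of_ne _ h₂, slope_def_field, hGv z hz l h₁,
    hGv z hz α₂ (Ne.symm hα), hF₂ z hz, Matrix.zero_apply, mul_zero, sub_zero, Matrix.smul_apply,
    smul_eq_mul, div_eq_inv_mul]
  ring

/-- Write `N = l - τ`. Differentiating `E' N = N₀ E` gives `D N - E' T = E' N G`; since `N G + T =
G' N`, the invertible factor `N` cancels. -/
lemma eq_of_dressed_relation {E E' τ : ℝ → Mat n} {N₀ D G G' T : Mat n} {s : ℝ} {l : ℂ}
    (hE' : HasMatDeriv E' D s) (hE : HasMatDeriv E (E s * G) s) (hτ : HasMatDeriv τ T s)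
    (hrel : ∀ᶠ r in nhds s, E' r * (l • 1 - τ r) = N₀ * E r)
    (hG : (l • 1 - τ s) * G - G' * (l • 1 - τ s) = -T) (hu : IsUnit (l • 1 - τ s)) :
    D = E' s * G' := by
  have h1 := hE'.mul ((HasMatDeriv.const (l • (1 : Mat n)) s).sub hτ)
  have h2 := ((HasMatDeriv.const N₀ s).mul hE).congr (hrel.mono fun r hr => hr.symm)
  have h3 := h1.unique h2
  have h4 := hrel.self_of_nhds
  generalize l • 1 - τ s = N at *
  rw [zero_mul, zero_add, ← mul_assoc, ← h4, zero_sub, ← hG] at h3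
  refine hu.mul_right_cancel ?_
  calc D * N = D * N + E' s * (N * G - G' * N) - E' s * (N * G - G' * N) := by abel
    _ = E' s * G' * N := by
      rw [h3]
      noncomm_ring

lemma dense_compl_pair (α₁ α₂ : ℂ) : Dense ({α₁, α₂}ᶜ : Set ℂ) :=
  ((Set.toFinite {α₁, α₂}).countable).dense_compl ℂ

/-- The gauge factor is invertible only for `l ≠ α₁, α₂`; identities proved there reach the two
points by continuity. -/
lemma eq_of_eq_off_pair {X : Type*} [TopologicalSpace X] [T2Space X] {f g : ℂ → X}
    (hf : Continuous f) (hg : Continuous g)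
    (h : ∀ l, l ≠ α₁ → l ≠ α₂ → f l = g l) (l : ℂ) : f l = g l := by
  have : Set.EqOn f g {α₁, α₂}ᶜ := fun l hl => by
    simp only [mem_compl_iff, mem_insert_iff, mem_singleton_iff, not_or] at hl
    exact h l hl.1 hl.2
  exact congrFun (hf.ext_on (dense_compl_pair α₁ α₂) hg this) l

lemma SmoothOn.continuous_slice {F : (ℝ × ℝ) × ℂ → Mat n} (hF : SmoothOn F (O ×ˢ univ))
    {z : ℝ × ℝ} (hz : z ∈ O) : Continuous fun l => F (z, l) :=
  hF.continuousOn.comp_continuous (by fun_prop) fun _ => ⟨hz, mem_univ _⟩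

lemma lie_add_smul_idem (B : Mat n) (α₁ α₂ : ℂ) (σ : Mat n) :
    ⁅B, α₂ • (1 : Mat n) + (α₁ - α₂) • σ⁆ = (α₁ - α₂) • ⁅B, σ⁆ := by
  simp only [Ring.lie_def, mul_add, add_mul, mul_smul_comm, smul_mul_assoc, mul_one, one_mul,
    smul_sub]
  abel

variable {a : Fin n → ℂ} {p : Polynomial ℂ} {j : ℕ} {u : ℝ × ℝ → Mat n}

/-- The function `τ = α₂ + (α₁ - α₂) σ` solves the `x`-part of the gauge equation. -/
lemma SolvesProjSystem.hasPartialX_gauge (h : SolvesProjSystem a p j O u α₁ α₂ π σ) {z : ℝ × ℝ}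
    (hz : z ∈ O) :
    HasPartialX (fun w => α₂ • (1 : Mat n) + (α₁ - α₂) • σ w)
      (-⁅u z, α₂ • (1 : Mat n) + (α₁ - α₂) • σ z⁆
        - ⁅Matrix.diagonal a, α₂ • (1 : Mat n) + (α₁ - α₂) • σ z⁆
          * (α₂ • (1 : Mat n) + (α₁ - α₂) • σ z)) z := by
  have h1 : HasMatDeriv (fun s => α₂ • (1 : Mat n) + (α₁ - α₂) • σ (s, z.2)) _ z.1 :=
    (HasMatDeriv.const (α₂ • (1 : Mat n)) z.1).add (HasMatDeriv.smul (α₁ - α₂) (h.eq_x z hz))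
  rw [zero_add] at h1
  rw [lie_add_smul_idem, lie_add_smul_idem, smul_mul_assoc, ← smul_neg, ← smul_sub]
  exact h1

lemma SolvesProjSystem.hasPartialT_gauge (h : SolvesProjSystem a p j O u α₁ α₂ π σ) {z : ℝ × ℝ}
    (hz : z ∈ O) :
    HasPartialT (fun w => α₂ • (1 : Mat n) + (α₁ - α₂) • σ w)
      (-∑ k ∈ Finset.range (j + 1), ⁅Qb a p u (j - k) z, α₂ • (1 : Mat n) + (α₁ - α₂) • σ z⁆
          * (α₂ • (1 : Mat n) + (α₁ - α₂) • σ z) ^ k) z := by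
  have h1 : HasMatDeriv (fun s => α₂ • (1 : Mat n) + (α₁ - α₂) • σ (z.1, s)) _ z.2 :=
    (HasMatDeriv.const (α₂ • (1 : Mat n)) z.2).add (HasMatDeriv.smul (α₁ - α₂) (h.eq_t z hz))
  rw [zero_add] at h1
  simp only [lie_add_smul_idem, smul_mul_assoc]
  rw [← Finset.smul_sum, ← smul_neg]
  exact h1

/-- A smooth extension of the dressed trivialization is a trivialization of the dressed
potential. -/
lemma isTrivialization_dressed (hO : IsOpen O) (h0 : (0, 0) ∈ O) (hu : SmoothOn u O)
    (hE : IsTrivialization a p j O u E) (hσ : SolvesProjSystem a p j O u α₁ α₂ π σ)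
    (hdet : ∀ z ∈ O, ∃ M : Mat n, IsUnit M ∧ σ z = M * π * M⁻¹)
    {E' : ℝ × ℝ → ℂ → Mat n}
    (hE' : ∀ z ∈ O, ∀ l, l ≠ α₁ → l ≠ α₂ → E' z l = simpleElement α₁ α₂ π l * E z l
        * (simpleElement α₁ α₂ (σ z) l)⁻¹)
    (hs : SmoothOn (fun q : (ℝ × ℝ) × ℂ => E' q.1 q.2) (O ×ˢ univ)) :
    IsTrivialization a p j O (fun z => u z + (α₁ - α₂) • ⁅Matrix.diagonal a, σ z⁆) E' := by
  set τ : ℝ × ℝ → Mat n := fun w => α₂ • (1 : Mat n) + (α₁ - α₂) • σ w with hτ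
  set τ₀ : Mat n := α₂ • (1 : Mat n) + (α₁ - α₂) • π with hτ₀
  have hu' : (fun z => u z + (α₁ - α₂) • ⁅Matrix.diagonal a, σ z⁆)
      = fun z => u z + ⁅Matrix.diagonal a, τ z⁆ := by
    funext z
    rw [hτ, lie_add_smul_idem]
  rw [hu']
  have hτx : ∀ z ∈ O, HasPartialX τ (-⁅u z, τ z⁆ - ⁅Matrix.diagonal a, τ z⁆ * τ z) z :=
    fun z hz => hσ.hasPartialX_gauge hz
  have hτt : ∀ z ∈ O, HasPartialT τ
      (-∑ k ∈ Finset.range (j + 1), ⁅Qb a p u (j - k) z, τ z⁆ * τ z ^ k) z :=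
    fun z hz => hσ.hasPartialT_gauge hz
  have hrel : ∀ z ∈ O, ∀ l, l ≠ α₁ → l ≠ α₂ →
      E' z l * (l • 1 - τ z) = (l • 1 - τ₀) * E z l := by
    intro z hz l h₁ h₂
    have hid := hσ.idem z hz
    have hu := (Matrix.isUnit_iff_isUnit_det _).mp (isUnit_simpleElement hid h₁ h₂)
    rw [hE' z hz l h₁ h₂, hτ, hτ₀]
    simp only
    rw [← smul_simpleElement _ _ _ h₁, ← smul_simpleElement _ _ _ h₁, mul_smul_comm,
      smul_mul_assoc, mul_assoc, Matrix.nonsing_inv_mul _ hu, mul_one]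
  have hunit : ∀ z ∈ O, ∀ l, l ≠ α₁ → l ≠ α₂ → IsUnit (l • 1 - τ z) :=
    fun z hz l h₁ h₂ => isUnit_sub_of_idem (hσ.idem z hz) h₁ h₂
  have hUo : IsOpen (O ×ˢ (univ : Set ℂ)) := hO.prod isOpen_univ
  refine ⟨hs, fun z hz l => ?_, fun z hz l => ?_, fun z hz l => ?_, fun l => ?_⟩
  -- Since `σ z` is conjugate to `π`, the factors `l - τ z` and `l - τ₀` have equal determinants, so
  -- dressing preserves the determinant of `E`.
  · have hdet' : (E' z l).det = (E z l).det := by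
      refine eq_of_eq_off_pair (α₁ := α₁) (α₂ := α₂) (f := fun l => (E' z l).det)
        (g := fun l => (E z l).det) ?_ ?_ (fun l h₁ h₂ => ?_) l
      · exact (hs.continuous_slice hz).matrix_det
      · exact (hE.smooth.continuous_slice hz).matrix_det
      · obtain ⟨M, hM, hMσ⟩ := hdet z hz
        have hMd := (Matrix.isUnit_iff_isUnit_det _).mp hM
        have hconj : l • 1 - τ z = M * (l • 1 - τ₀) * M⁻¹ := by
          simp only [hτ, hτ₀, hMσ, mul_sub, sub_mul, mul_add, add_mul, mul_smul_comm,
            smul_mul_assoc, mul_one, Matrix.mul_nonsing_inv _ hMd]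
        have hd : (l • 1 - τ z).det = (l • 1 - τ₀).det := by
          rw [hconj, Matrix.det_mul_right_comm, Matrix.mul_nonsing_inv _ hMd, one_mul]
        have h := congrArg Matrix.det (hrel z hz l h₁ h₂)
        rw [Matrix.det_mul, Matrix.det_mul, ← hd, mul_comm] at h
        exact mul_left_cancel₀
          ((Matrix.isUnit_iff_isUnit_det _).mp (hunit z hz l h₁ h₂)).ne_zero h
    rw [Matrix.isUnit_iff_isUnit_det, hdet', ← Matrix.isUnit_iff_isUnit_det]
    exact hE.invertible z hz l
  -- Joint smoothness gives the derivative for every `l`; its value is found off the two points and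
  -- extended by continuity in `l`.
  · have hd : ∀ l, HasPartialX (fun w => E' w l) _ z := fun l =>
      hs.hasMatDeriv_comp (γ := fun s => ((s, z.2), l)) hUo ⟨hz, mem_univ l⟩
        (((hasDerivAt_id z.1).prodMk (hasDerivAt_const z.1 z.2)).prodMk (hasDerivAt_const z.1 l))
    have hval := eq_of_eq_off_pair (α₁ := α₁) (α₂ := α₂)
      (g := fun l => E' z l * (l • Matrix.diagonal a + (u z + ⁅Matrix.diagonal a, τ z⁆)))
      ((hs.fderiv_apply hUo (((1, 0), 0) : (ℝ × ℝ) × ℂ)).continuous_slice hz)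
      ((hs.continuous_slice hz).mul (by fun_prop)) (fun l h₁ h₂ => ?_) l
    · rw [← hval]
      exact hd l
    · refine eq_of_dressed_relation (E := fun s => E (s, z.2) l) (E' := fun s => E' (s, z.2) l)
        (τ := fun s => τ (s, z.2)) (N₀ := l • 1 - τ₀) (hd l) (hE.eq_x z hz l) (hτx z hz) ?_ ?_
        (hunit z hz l h₁ h₂)
      · filter_upwards [eventually_slice_x hO hz] with r hr
        exact hrel (r, z.2) hr l h₁ h₂
      · rw [Prod.mk.eta]
        simp only [Ring.lie_def, mul_add, add_mul, mul_sub, sub_mul, smul_mul_assoc,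
          mul_smul_comm, one_mul, mul_one, smul_add, smul_sub]
        abel
  · rw [flowSymbol_eq]
    have hd : ∀ l, HasPartialT (fun w => E' w l) _ z := fun l =>
      hs.hasMatDeriv_comp (γ := fun s => ((z.1, s), l)) hUo ⟨hz, mem_univ l⟩
        (((hasDerivAt_const z.2 z.1).prodMk (hasDerivAt_id z.2)).prodMk (hasDerivAt_const z.2 l))
    have hval := eq_of_eq_off_pair (α₁ := α₁) (α₂ := α₂)
      (g := fun l => E' z l * flowSymbol a p j (fun w => u w + ⁅Matrix.diagonal a, τ w⁆) z l)
      ((hs.fderiv_apply hUo (((0, 1), 0) : (ℝ × ℝ) × ℂ)).continuous_slice hz)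
      ((hs.continuous_slice hz).mul (by unfold flowSymbol; fun_prop)) (fun l h₁ h₂ => ?_) l
    · rw [← hval]
      exact hd l
    · refine eq_of_dressed_relation (E := fun s => E (z.1, s) l) (E' := fun s => E' (z.1, s) l)
        (τ := fun s => τ (z.1, s)) (N₀ := l • 1 - τ₀) (G := flowSymbol a p j u z l)
        (hd l) ?_ (hτt z hz) ?_ ?_ (hunit z hz l h₁ h₂)
      · have := hE.eq_t z hz l
        rw [flowSymbol_eq] at this
        exact this
      · filter_upwards [eventually_slice_t hO hz] with r hr
        exact hrel (z.1, r) hr l h₁ h₂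
      · rw [neg_neg]
        exact flowSymbol_gauge hO a p j hu hτx hz l
  · refine eq_of_eq_off_pair (α₁ := α₁) (α₂ := α₂) (g := fun _ => 1)
      (hs.continuous_slice h0) continuous_const (fun l h₁ h₂ => ?_) l
    rw [hE' _ h0 l h₁ h₂, hE.normalized, hσ.initial, mul_one]
    have hid : π * π = π := by have := hσ.idem _ h0; rwa [hσ.initial] at this
    exact Matrix.mul_nonsing_inv _ ((Matrix.isUnit_iff_isUnit_det _).mp
      (isUnit_simpleElement hid h₁ h₂))

end Dressing

/-! ### Zero curvature -/

section ZeroCurvature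

variable {n : ℕ} {O : Set (ℝ × ℝ)}

lemma fderiv_fderiv_apply_comm {f : ℝ × ℝ → ℂ} (hO : IsOpen O) (hf : ContDiffOn ℝ ∞ f O)
    {z : ℝ × ℝ} (hz : z ∈ O) (v w : ℝ × ℝ) :
    fderiv ℝ (fun y => fderiv ℝ f y v) z w = fderiv ℝ (fun y => fderiv ℝ f y w) z v := by
  have hd : DifferentiableAt ℝ (fderiv ℝ f) z :=
    ((hf.fderiv_of_isOpen hO (m := ∞) (by simp)).contDiffAt (hO.mem_nhds hz)).differentiableAt
      (by simp)
  have hsymm : IsSymmSndFDerivAt ℝ f z :=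
    (hf.contDiffAt (hO.mem_nhds hz)).isSymmSndFDerivAt (by simpa using (WithTop.coe_le_coe.mpr (le_top : (2 : ℕ∞) ≤ ⊤)))
  rw [fderiv_clm_apply hd (differentiableAt_const v), fderiv_clm_apply hd (differentiableAt_const w)]
  simpa using hsymm.eq w v

/-- The zero curvature equation of a pair of compatible linear systems. -/
lemma hasPartialT_of_compatible (hO : IsOpen O) {V A B : ℝ × ℝ → Mat n} (hV : SmoothOn V O)
    (hA : SmoothOn A O) (hB : SmoothOn B O) (hu : ∀ z ∈ O, IsUnit (V z))
    (hx : ∀ z ∈ O, HasPartialX V (V z * A z) z) (ht : ∀ z ∈ O, HasPartialT V (V z * B z) z)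
    {z : ℝ × ℝ} (hz : z ∈ O) : HasPartialT A (partialX B z + ⁅A z, B z⁆) z := by
  have hAt := hA.hasPartialT_fderiv hO hz
  set At : Mat n := Matrix.of fun i k => fderiv ℝ (fun w => A w i k) z (0, 1)
  have hVx : ∀ w ∈ O, (Matrix.of fun i k => fderiv ℝ (fun y => V y i k) w (1, 0)) = V w * A w :=
    fun w hw => HasMatDeriv.unique (hV.hasPartialX_fderiv hO hw) (hx w hw)
  have hVt : ∀ w ∈ O, (Matrix.of fun i k => fderiv ℝ (fun y => V y i k) w (0, 1)) = V w * B w :=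
    fun w hw => HasMatDeriv.unique (hV.hasPartialT_fderiv hO hw) (ht w hw)
  have h1 : HasMatDeriv (fun s => V (z.1, s) * A (z.1, s))
      (Matrix.of fun i k => fderiv ℝ (fun y => fderiv ℝ (fun y => V y i k) y (1, 0)) z (0, 1))
      z.2 := by
    refine HasMatDeriv.congr ((hV.fderiv_apply hO (1, 0)).hasPartialT_fderiv hO hz) ?_
    filter_upwards [eventually_slice_t hO hz] with r hr
    exact hVx _ hr
  have h2 : HasMatDeriv (fun s => V (s, z.2) * B (s, z.2))
      (Matrix.of fun i k => fderiv ℝ (fun y => fderiv ℝ (fun y => V y i k) y (0, 1)) z (1, 0))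
      z.1 := by
    refine HasMatDeriv.congr ((hV.fderiv_apply hO (0, 1)).hasPartialX_fderiv hO hz) ?_
    filter_upwards [eventually_slice_x hO hz] with r hr
    exact hVt _ hr
  have e1 : _ = V z * B z * A z + V z * At := h1.unique (HasMatDeriv.mul (ht z hz) hAt)
  have e2 : _ = V z * A z * B z + V z * partialX B z :=
    h2.unique (HasMatDeriv.mul (hx z hz) (hB.hasPartialX hO hz))
  -- Equality of the mixed partial derivatives of `V`.
  have e : V z * B z * A z + V z * At = V z * A z * B z + V z * partialX B z := by
    rw [← e1, ← e2]
    ext i k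
    exact fderiv_fderiv_apply_comm hO (hV i k) hz _ _
  have : At = partialX B z + ⁅A z, B z⁆ := by
    refine (hu z hz).mul_left_cancel ?_
    rw [Ring.lie_def, mul_add, mul_sub, ← mul_assoc, ← mul_assoc]
    calc V z * At = V z * B z * A z + V z * At - V z * B z * A z := by abel
      _ = _ := by rw [e]; abel
  rw [← this]
  exact hAt

/-- A potential with a trivialization solves the flow. -/
lemma IsTrivialization.flow {a : Fin n → ℂ} {p : Polynomial ℂ} {j : ℕ} {u : ℝ × ℝ → Mat n}
    {E : ℝ × ℝ → ℂ → Mat n} (hE : IsTrivialization a p j O u E) (hO : IsOpen O)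
    (hu : SmoothOn u O) {z : ℝ × ℝ} (hz : z ∈ O) :
    HasPartialT u (partialX (Qb a p u j) z + ⁅u z, Qb a p u j z⁆) z := by
  -- At `l = 0` the linear systems read `V_x = V u` and `V_t = V Q_{b,j}(u)`, so zero curvature is
  -- the flow itself.
  refine hasPartialT_of_compatible hO (V := fun w => E w 0) ?_ hu (smoothOn_Qb hO a p hu j)
    (fun w hw => hE.invertible w hw 0) (fun w hw => ?_) (fun w hw => ?_) hz
  · exact hE.smooth.comp (φ := fun w => (w, (0 : ℂ))) (by fun_prop) fun w hw => ⟨hw, Set.mem_univ _⟩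
  · simpa using hE.eq_x w hw 0
  · have := hE.eq_t w hw 0
    rwa [flowSymbol_eq, flowSymbol_zero_right] at this

/-- Cyclicity of the trace: `tr(w[a, B]) = tr([w, a]B)`, which is zero when `w` commutes with `a`.
-/
lemma lie_diagonal_mem_slPerp (a : Fin n → ℂ) (B : Mat n) : ⁅Matrix.diagonal a, B⁆ ∈ slPerp a := by
  refine ⟨by rw [Ring.lie_def, Matrix.trace_sub, Matrix.trace_mul_comm, sub_self], ?_⟩
  rintro w ⟨-, hw⟩
  rw [Ring.lie_def, sub_eq_zero] at hw
  rw [Ring.lie_def, mul_sub, Matrix.trace_sub, ← mul_assoc, ← hw, ← mul_assoc,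
    Matrix.trace_mul_comm (w * B), ← mul_assoc, sub_self]

lemma add_smul_mem_slPerp {a : Fin n → ℂ} {y w : Mat n} (hy : y ∈ slPerp a) (hw : w ∈ slPerp a)
    (c : ℂ) : y + c • w ∈ slPerp a := by
  refine ⟨by simp [hy.1, hw.1], fun v hv => ?_⟩
  rw [mul_add, mul_smul_comm, Matrix.trace_add, Matrix.trace_smul, hy.2 v hv, hw.2 v hv, smul_zero,
    add_zero]

end ZeroCurvature

/-! ### Expansions at infinity -/

section Expansion

variable {n : ℕ} {O : Set (ℝ × ℝ)} {Γ : Set ℂ} {m m' : ℝ × ℝ → ℂ → Mat n}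
  {c c' : ℕ → ℝ × ℝ → Mat n}

lemma HasExpansionAtInfty.mono {O' : Set (ℝ × ℝ)} (h : HasExpansionAtInfty O Γ m c)
    (hO : O' ⊆ O) : HasExpansionAtInfty O' Γ m c :=
  fun N K hK => h N K (hK.trans hO)

lemma HasExpansionAtInfty.add (h : HasExpansionAtInfty O Γ m c)
    (h' : HasExpansionAtInfty O Γ m' c') :
    HasExpansionAtInfty O Γ (fun z l => m z l + m' z l) (fun r z => c r z + c' r z) := by
  intro N K hK hKc
  obtain ⟨C, R, hC⟩ := h N K hK hKc
  obtain ⟨C', R', hC'⟩ := h' N K hK hKc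
  refine ⟨C + C', max R R', fun z hz l hl hR i k => ?_⟩
  have e : m z l + m' z l - ∑ r ∈ Finset.range (N + 1), (l ^ r)⁻¹ • (c r z + c' r z)
      = (m z l - ∑ r ∈ Finset.range (N + 1), (l ^ r)⁻¹ • c r z)
        + (m' z l - ∑ r ∈ Finset.range (N + 1), (l ^ r)⁻¹ • c' r z) := by
    simp only [smul_add, Finset.sum_add_distrib]
    abel
  rw [e, Matrix.add_apply, add_mul]
  exact (norm_add_le _ _).trans (add_le_add (hC z hz l hl ((le_max_left _ _).trans hR) i k)
    (hC' z hz l hl ((le_max_right _ _).trans hR) i k))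

lemma HasExpansionAtInfty.mul_right (h : HasExpansionAtInfty O Γ m c) {B : ℝ × ℝ → Mat n}
    (hB : SmoothOn B O) :
    HasExpansionAtInfty O Γ (fun z l => m z l * B z) (fun r z => c r z * B z) := by
  intro N K hK hKc
  obtain ⟨C, R, hC⟩ := h N K hK hKc
  have hb : ∀ i k, ∃ b, ∀ z ∈ K, ‖B z i k‖ ≤ b := fun i k =>
    hKc.exists_bound_of_continuousOn ((hB i k).continuousOn.mono hK)
  choose b hb using hb
  refine ⟨∑ i, ∑ k, |C| * |b i k|, R, fun z hz l hl hR i k => ?_⟩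
  have e : m z l * B z - ∑ r ∈ Finset.range (N + 1), (l ^ r)⁻¹ • (c r z * B z)
      = (m z l - ∑ r ∈ Finset.range (N + 1), (l ^ r)⁻¹ • c r z) * B z := by
    simp only [sub_mul, Finset.sum_mul, smul_mul_assoc]
  rw [e, Matrix.mul_apply]
  have hpow : 0 ≤ (‖l‖ ^ (N + 1))⁻¹ := by positivity
  calc _ ≤ ∑ x, |C| * (‖l‖ ^ (N + 1))⁻¹ * |b x k| := by
        refine norm_sum_le_of_le _ fun x _ => ?_
        rw [norm_mul]
        refine mul_le_mul ((hC z hz l hl hR i x).trans ?_) ((hb x k z hz).trans (le_abs_self _))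
          (norm_nonneg _) (by positivity)
        exact mul_le_mul_of_nonneg_right (le_abs_self C) hpow
    _ = (∑ x, |C| * |b x k|) * (‖l‖ ^ (N + 1))⁻¹ := by
        rw [Finset.sum_mul]
        exact Finset.sum_congr rfl fun x _ => by ring
    _ ≤ _ := by
        refine mul_le_mul_of_nonneg_right (Finset.sum_le_sum fun x _ => ?_) hpow
        exact Finset.single_le_sum (f := fun k => |C| * |b x k|) (fun _ _ => by positivity)
          (Finset.mem_univ k)

/-- Coefficients of the expansion of `m / (l - α)`. -/
noncomputable def divCoeff (c : ℕ → ℝ × ℝ → Mat n) (α : ℂ) : ℕ → ℝ × ℝ → Mat n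
  | 0 => fun _ => 0
  | r + 1 => fun z => c r z + α • divCoeff c α r z

lemma smoothOn_divCoeff (hc : ∀ r, SmoothOn (c r) O) (α : ℂ) (r : ℕ) :
    SmoothOn (divCoeff c α r) O := by
  induction r with
  | zero => exact SmoothOn.const 0 O
  | succ r ih => exact (hc r).add (SmoothOn.smul contDiffOn_const ih)

/-- From `(l - α)⁻¹ = l⁻¹ + α l⁻¹ (l - α)⁻¹`, the next remainder of the quotient is `l⁻¹` times
known remainders of `m` and of the quotient. The induction starts from boundedness of `m` near
infinity. -/
lemma HasExpansionAtInfty.div_sub (h : HasExpansionAtInfty O Γ m c)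
    (hc : SmoothOn (c 0) O) (α : ℂ) :
    HasExpansionAtInfty O Γ (fun z l => (l - α)⁻¹ • m z l) (divCoeff c α) := by
  have key : ∀ (N : ℕ) (z : ℝ × ℝ) (l : ℂ), l ≠ 0 → l ≠ α →
      (l - α)⁻¹ • m z l - ∑ r ∈ Finset.range (N + 1 + 1), (l ^ r)⁻¹ • divCoeff c α r z
        = l⁻¹ • ((m z l - ∑ r ∈ Finset.range (N + 1), (l ^ r)⁻¹ • c r z)
          + α • ((l - α)⁻¹ • m z l
            - ∑ r ∈ Finset.range (N + 1), (l ^ r)⁻¹ • divCoeff c α r z)) := by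
    intro N z l hl hα
    have hne : l - α ≠ 0 := sub_ne_zero.mpr hα
    have e1 : ∑ r ∈ Finset.range (N + 1 + 1), (l ^ r)⁻¹ • divCoeff c α r z
        = l⁻¹ • (∑ r ∈ Finset.range (N + 1), (l ^ r)⁻¹ • c r z)
          + l⁻¹ • α • ∑ r ∈ Finset.range (N + 1), (l ^ r)⁻¹ • divCoeff c α r z := by
      rw [Finset.sum_range_succ', Finset.smul_sum, Finset.smul_sum, Finset.smul_sum,
        ← Finset.sum_add_distrib]
      simp only [divCoeff, smul_zero, add_zero]
      refine Finset.sum_congr rfl fun r _ => ?_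
      rw [pow_succ', mul_inv, smul_add, smul_smul, smul_smul, smul_smul, smul_smul]
      congr 2
      ring
    have e2 : (l - α)⁻¹ • m z l = l⁻¹ • m z l + l⁻¹ • α • (l - α)⁻¹ • m z l := by
      rw [smul_smul, smul_smul, ← add_smul]
      congr 1
      field_simp
      ring
    rw [e1]
    conv_lhs => rw [e2]
    simp only [smul_add, smul_sub]
    abel
  intro N K hK hKc
  induction N with
  | zero =>
    obtain ⟨C, R, hC⟩ := h 0 K hK hKc
    have hb : ∀ i k, ∃ b, ∀ z ∈ K, ‖c 0 z i k‖ ≤ b := fun i k =>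
      hKc.exists_bound_of_continuousOn ((hc i k).continuousOn.mono hK)
    choose b hb using hb
    -- The threshold `2‖α‖ + 1` gives `‖l - α‖ ≥ ‖l‖ / 2`, the source of the factor `2`.
    refine ⟨2 * (|C| + ∑ i, ∑ k, |b i k|), max R (2 * ‖α‖ + 1), fun z hz l hl hR i k => ?_⟩
    have hl1 : 2 * ‖α‖ + 1 ≤ ‖l‖ := (le_max_right _ _).trans hR
    have hl0 : 1 ≤ ‖l‖ := by linarith [norm_nonneg α]
    have hlα : ‖l‖ / 2 ≤ ‖l - α‖ := by linarith [norm_sub_norm_le l α]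
    have h1 := hC z hz l hl ((le_max_left _ _).trans hR) i k
    have hbs : ‖c 0 z i k‖ ≤ ∑ i, ∑ k, |b i k| :=
      ((hb i k z hz).trans (le_abs_self _)).trans
        ((Finset.single_le_sum (f := fun k => |b i k|) (fun _ _ => abs_nonneg _)
          (Finset.mem_univ k)).trans
        (Finset.single_le_sum (f := fun i => ∑ k, |b i k|)
          (fun _ _ => Finset.sum_nonneg fun _ _ => abs_nonneg _) (Finset.mem_univ i)))
    have hm : ‖m z l i k‖ ≤ |C| + ∑ i, ∑ k, |b i k| := by
      simp only [zero_add, Finset.sum_range_one, pow_zero, inv_one, one_smul, pow_one,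
        Matrix.sub_apply] at h1
      have h2 : C * ‖l‖⁻¹ ≤ |C| :=
        (mul_le_mul_of_nonneg_right (le_abs_self C) (by positivity)).trans
          (mul_le_of_le_one_right (abs_nonneg C) (inv_le_one_of_one_le₀ hl0))
      have h3 := norm_add_le (m z l i k - c 0 z i k) (c 0 z i k)
      rw [sub_add_cancel] at h3
      linarith
    simp only [zero_add, Finset.sum_range_one, divCoeff, smul_zero, sub_zero, pow_one,
      Matrix.smul_apply, smul_eq_mul, norm_mul, norm_inv]
    have h4 : ‖l - α‖⁻¹ ≤ 2 * ‖l‖⁻¹ := by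
      rw [show 2 * ‖l‖⁻¹ = (‖l‖ / 2)⁻¹ by rw [inv_div, div_eq_mul_inv]]
      exact inv_anti₀ (by linarith) hlα
    calc ‖l - α‖⁻¹ * ‖m z l i k‖ ≤ (2 * ‖l‖⁻¹) * (|C| + ∑ i, ∑ k, |b i k|) :=
          mul_le_mul h4 hm (norm_nonneg _) (by positivity)
      _ = _ := by ring
  | succ N ih =>
    obtain ⟨C, R, hC⟩ := h N K hK hKc
    obtain ⟨C', R', hC'⟩ := ih
    refine ⟨C + ‖α‖ * C', max (max R R') (‖α‖ + 1), fun z hz l hl hR i k => ?_⟩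
    have hl1 : ‖α‖ + 1 ≤ ‖l‖ := (le_max_right _ _).trans hR
    have hl0 : l ≠ 0 := norm_pos_iff.mp (by linarith [norm_nonneg α])
    have hlα : l ≠ α := by
      rintro rfl
      linarith
    have h1 := hC z hz l hl (((le_max_left _ _).trans (le_max_left _ _)).trans hR) i k
    have h2 := hC' z hz l hl (((le_max_right _ _).trans (le_max_left _ _)).trans hR) i k
    rw [key N z l hl0 hlα, Matrix.smul_apply, Matrix.add_apply, Matrix.smul_apply, smul_eq_mul,
      smul_eq_mul, norm_mul, norm_inv]
    calc _ ≤ ‖l‖⁻¹ * (C * (‖l‖ ^ (N + 1))⁻¹ + ‖α‖ * (C' * (‖l‖ ^ (N + 1))⁻¹)) := by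
          refine mul_le_mul_of_nonneg_left ((norm_add_le _ _).trans (add_le_add h1 ?_))
            (by positivity)
          rw [norm_mul]
          exact mul_le_mul_of_nonneg_left h2 (norm_nonneg _)
      _ = _ := by
          rw [pow_succ _ (N + 1), mul_inv]
          ring

end Expansion

/-! ### Uniqueness for the projection system -/

section Uniqueness

open Set

variable {n : ℕ}

attribute [local instance] Matrix.linftyOpNormedAddCommGroup Matrix.linftyOpNormedRing
  Matrix.linftyOpNormedSpace

lemma HasMatDeriv.hasDerivAt {f : ℝ → Mat n} {D : Mat n} {s : ℝ} (h : HasMatDeriv f D s) :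
    HasDerivAt f D s :=
  hasDerivAt_pi.mpr fun i => hasDerivAt_pi.mpr fun k => h i k

/-- Solutions of a matrix Riccati equation are determined by one value. -/
lemma riccati_eqOn {f g G₁ G₂ : ℝ → Mat n} {b c s₀ : ℝ} (hs₀ : s₀ ∈ Ioo b c)
    (hf : ∀ s ∈ Icc b c, HasMatDeriv f
      (-(G₁ s * f s) + f s * G₁ s * f s + f s * G₂ s * (1 - f s)) s)
    (hg : ∀ s ∈ Icc b c, HasMatDeriv g
      (-(G₁ s * g s) + g s * G₁ s * g s + g s * G₂ s * (1 - g s)) s)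
    (hG₁ : ContinuousOn G₁ (Icc b c)) (hG₂ : ContinuousOn G₂ (Icc b c)) (h0 : f s₀ = g s₀) :
    EqOn f g (Icc b c) := by
  have cf : ContinuousOn f (Icc b c) :=
    fun s hs => (hf s hs).hasDerivAt.continuousAt.continuousWithinAt
  have cg : ContinuousOn g (Icc b c) :=
    fun s hs => (hg s hs).hasDerivAt.continuousAt.continuousWithinAt
  obtain ⟨B, hB⟩ := (isCompact_Icc (a := b) (b := c)).exists_bound_of_continuousOn
    (f := fun s => ‖G₁ s - G₂ s‖ * ‖f s‖ + ‖g s‖ * ‖G₁ s - G₂ s‖ + ‖G₁ s‖ + ‖G₂ s‖)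
    ((((hG₁.sub hG₂).norm.mul cf.norm).add (cg.norm.mul (hG₁.sub hG₂).norm)).add hG₁.norm |>.add
      hG₂.norm)
  -- The difference `y = f - g` solves the linear equation `y' = v s y`, with `f` and `g` frozen as
  -- bounded coefficients; hence a global Lipschitz constant.
  set v : ℝ → Mat n → Mat n := fun s y =>
    y * (G₁ s - G₂ s) * f s + g s * (G₁ s - G₂ s) * y - G₁ s * y + y * G₂ s with hv
  have hlip : ∀ s ∈ Ioo b c, LipschitzOnWith B.toNNReal (v s) univ := by
    intro s hs
    refine LipschitzWith.lipschitzOnWith (LipschitzWith.of_dist_le_mul fun y w => ?_)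
    have e : v s y - v s w = (y - w) * (G₁ s - G₂ s) * f s + g s * (G₁ s - G₂ s) * (y - w)
        - G₁ s * (y - w) + (y - w) * G₂ s := by
      simp only [hv]
      noncomm_ring
    rw [dist_eq_norm, dist_eq_norm, e]
    have hBs := (le_abs_self _).trans (hB s (Ioo_subset_Icc_self hs))
    have n1 : ‖(y - w) * (G₁ s - G₂ s) * f s‖ ≤ ‖G₁ s - G₂ s‖ * ‖f s‖ * ‖y - w‖ :=
      (norm_mul_le _ _).trans ((mul_le_mul_of_nonneg_right (norm_mul_le _ _)
        (norm_nonneg _)).trans_eq (by ring))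
    have n2 : ‖g s * (G₁ s - G₂ s) * (y - w)‖ ≤ ‖g s‖ * ‖G₁ s - G₂ s‖ * ‖y - w‖ :=
      (norm_mul_le _ _).trans (mul_le_mul_of_nonneg_right (norm_mul_le _ _) (norm_nonneg _))
    have n3 : ‖G₁ s * (y - w)‖ ≤ ‖G₁ s‖ * ‖y - w‖ := norm_mul_le _ _
    have n4 : ‖(y - w) * G₂ s‖ ≤ ‖G₂ s‖ * ‖y - w‖ :=
      (norm_mul_le _ _).trans_eq (mul_comm _ _)
    calc _ ≤ ‖(y - w) * (G₁ s - G₂ s) * f s‖ + ‖g s * (G₁ s - G₂ s) * (y - w)‖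
            + ‖G₁ s * (y - w)‖ + ‖(y - w) * G₂ s‖ :=
          (norm_add_le _ _).trans (add_le_add_left ((norm_sub_le _ _).trans
            (add_le_add_left (norm_add_le _ _) _)) _)
      _ ≤ (‖G₁ s - G₂ s‖ * ‖f s‖ + ‖g s‖ * ‖G₁ s - G₂ s‖ + ‖G₁ s‖ + ‖G₂ s‖) * ‖y - w‖ := by
          linarith
      _ ≤ _ := mul_le_mul_of_nonneg_right (hBs.trans (Real.le_coe_toNNReal B)) (norm_nonneg _)
  have hd : ∀ s ∈ Ioo b c, HasDerivAt (fun s => f s - g s) (v s (f s - g s)) s := by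
    intro s hs
    have h1 := ((hf s (Ioo_subset_Icc_self hs)).sub (hg s (Ioo_subset_Icc_self hs))).hasDerivAt
    convert h1 using 1
    simp only [hv]
    noncomm_ring
  have hz : ∀ s ∈ Ioo b c, HasDerivAt (fun _ : ℝ => (0 : Mat n)) (v s 0) s := by
    intro s _
    have e : v s 0 = 0 := by simp [hv]
    rw [e]
    exact (HasMatDeriv.const 0 s).hasDerivAt
  have := ODE_solution_unique_of_mem_Icc hlip hs₀ (cf.sub cg) hd (fun _ _ => mem_univ _)
    continuousOn_const hz (fun _ _ => mem_univ _) (sub_eq_zero.mpr h0)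
  exact fun s hs => sub_eq_zero.mp (this hs)

variable {O : Set (ℝ × ℝ)} {a : Fin n → ℂ} {p : Polynomial ℂ} {j : ℕ} {u : ℝ × ℝ → Mat n}
  {α₁ α₂ : ℂ} {π : Mat n} {σ ρ : ℝ × ℝ → Mat n}

lemma SolvesProjSystem.hasPartialX_riccati (h : SolvesProjSystem a p j O u α₁ α₂ π σ) {z : ℝ × ℝ}
    (hz : z ∈ O) :
    HasPartialX σ (-((α₁ • Matrix.diagonal a + u z) * σ z)
      + σ z * (α₁ • Matrix.diagonal a + u z) * σ z
      + σ z * (α₂ • Matrix.diagonal a + u z) * (1 - σ z)) z := by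
  rw [riccati_eq_x (h.idem z hz)]
  exact h.eq_x z hz

lemma SolvesProjSystem.hasPartialT_riccati (h : SolvesProjSystem a p j O u α₁ α₂ π σ) {z : ℝ × ℝ}
    (hz : z ∈ O) :
    HasPartialT σ (-(flowSymbol a p j u z α₁ * σ z)
      + σ z * flowSymbol a p j u z α₁ * σ z
      + σ z * flowSymbol a p j u z α₂ * (1 - σ z)) z := by
  rw [flowSymbol, flowSymbol, riccati_eq_t (h.idem z hz)]
  exact h.eq_t z hz

/-- Balls of `ℝ × ℝ` are squares, so equality propagates from `w₀` horizontally by the `x`-equation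
and then vertically by the `t`-equation. -/
lemma SolvesProjSystem.eq_on_closedBall (hO : IsOpen O) (hu : SmoothOn u O)
    (h : SolvesProjSystem a p j O u α₁ α₂ π σ) (h' : SolvesProjSystem a p j O u α₁ α₂ π ρ)
    {z w₀ w : ℝ × ℝ} {r : ℝ} (hr : Metric.closedBall z r ⊆ O) (hw₀ : w₀ ∈ Metric.ball z r)
    (hw : w ∈ Metric.ball z r) (he : σ w₀ = ρ w₀) : σ w = ρ w := by
  have mem : ∀ x ∈ Icc (z.1 - r) (z.1 + r), ∀ t ∈ Icc (z.2 - r) (z.2 + r), (x, t) ∈ O := by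
    intro x hx t ht
    apply hr
    rw [← closedBall_prod_same, Real.closedBall_eq_Icc, Real.closedBall_eq_Icc]
    exact ⟨hx, ht⟩
  rw [← ball_prod_same, Real.ball_eq_Ioo, Real.ball_eq_Ioo] at hw₀ hw
  have e1 := riccati_eqOn (f := fun s => σ (s, w₀.2)) (g := fun s => ρ (s, w₀.2))
    (G₁ := fun s => α₁ • Matrix.diagonal a + u (s, w₀.2))
    (G₂ := fun s => α₂ • Matrix.diagonal a + u (s, w₀.2)) hw₀.1
    (fun s hs => h.hasPartialX_riccati (mem s hs w₀.2 (Ioo_subset_Icc_self hw₀.2)))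
    (fun s hs => h'.hasPartialX_riccati (mem s hs w₀.2 (Ioo_subset_Icc_self hw₀.2)))
    (continuousOn_const.add (hu.continuousOn.comp (by fun_prop)
      fun s hs => mem s hs w₀.2 (Ioo_subset_Icc_self hw₀.2)))
    (continuousOn_const.add (hu.continuousOn.comp (by fun_prop)
      fun s hs => mem s hs w₀.2 (Ioo_subset_Icc_self hw₀.2))) he (Ioo_subset_Icc_self hw.1)
  exact riccati_eqOn (f := fun s => σ (w.1, s)) (g := fun s => ρ (w.1, s))
    (G₁ := fun s => flowSymbol a p j u (w.1, s) α₁)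
    (G₂ := fun s => flowSymbol a p j u (w.1, s) α₂) hw₀.2
    (fun s hs => h.hasPartialT_riccati (mem w.1 (Ioo_subset_Icc_self hw.1) s hs))
    (fun s hs => h'.hasPartialT_riccati (mem w.1 (Ioo_subset_Icc_self hw.1) s hs))
    ((smoothOn_flowSymbol hO a p j hu α₁).continuousOn.comp (f := fun s : ℝ => (w.1, s))
      (by fun_prop) fun s hs => mem w.1 (Ioo_subset_Icc_self hw.1) s hs)
    ((smoothOn_flowSymbol hO a p j hu α₂).continuousOn.comp (f := fun s : ℝ => (w.1, s))
      (by fun_prop) fun s hs => mem w.1 (Ioo_subset_Icc_self hw.1) s hs)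
    e1 (Ioo_subset_Icc_self hw.2)

/-- The coincidence set and its complement in `O` are both open by propagation in balls, with no
appeal to joint continuity of the solutions. -/
lemma SolvesProjSystem.unique (hO : IsOpen O) (hc : IsPreconnected O) (h0 : (0, 0) ∈ O)
    (hu : SmoothOn u O) (h : SolvesProjSystem a p j O u α₁ α₂ π σ)
    (h' : SolvesProjSystem a p j O u α₁ α₂ π ρ) : EqOn σ ρ O := by
  have hball : ∀ z ∈ O, ∃ r > 0, Metric.closedBall z r ⊆ O := fun z hz =>
    Metric.nhds_basis_closedBall.mem_iff.mp (hO.mem_nhds hz)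
  have hopen₁ : IsOpen {z ∈ O | σ z = ρ z} := by
    refine Metric.isOpen_iff.mpr fun z hz => ?_
    obtain ⟨r, hr, hsub⟩ := hball z hz.1
    exact ⟨r, hr, fun w hw => ⟨hsub (Metric.ball_subset_closedBall hw),
      h.eq_on_closedBall hO hu h' hsub (Metric.mem_ball_self hr) hw hz.2⟩⟩
  have hopen₂ : IsOpen {z ∈ O | σ z ≠ ρ z} := by
    refine Metric.isOpen_iff.mpr fun z hz => ?_
    obtain ⟨r, hr, hsub⟩ := hball z hz.1
    exact ⟨r, hr, fun w hw => ⟨hsub (Metric.ball_subset_closedBall hw), fun he =>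
      hz.2 (h.eq_on_closedBall hO hu h' hsub hw (Metric.mem_ball_self hr) he)⟩⟩
  have hdisj : Disjoint {z ∈ O | σ z = ρ z} {z ∈ O | σ z ≠ ρ z} :=
    disjoint_left.mpr fun z hz hz' => hz'.2 hz.2
  have hsub := hc.subset_left_of_subset_union hopen₁ hopen₂ hdisj
    (fun z hz => (em (σ z = ρ z)).imp (fun e => ⟨hz, e⟩) fun e => ⟨hz, e⟩)
    ⟨(0, 0), h0, h0, h.initial.trans h'.initial.symm⟩
  exact fun z hz => (hsub hz).2

end Uniqueness

/-! ### The transformed projection of a trivialization -/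

section DressedProjection

open Set

variable {n : ℕ} {O : Set (ℝ × ℝ)} {a : Fin n → ℂ} {p : Polynomial ℂ} {j : ℕ}
  {u : ℝ × ℝ → Mat n} {E : ℝ × ℝ → ℂ → Mat n} {α₁ α₂ : ℂ} {π : Mat n}

lemma IsTrivialization.mono {O' : Set (ℝ × ℝ)} (h : IsTrivialization a p j O u E) (hO : O' ⊆ O) :
    IsTrivialization a p j O' u E :=
  ⟨h.smooth.mono (prod_mono hO subset_rfl), fun z hz => h.invertible z (hO hz),
    fun z hz => h.eq_x z (hO hz), fun z hz => h.eq_t z (hO hz), h.normalized⟩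

lemma IsTrivialization.smoothOn_slice (h : IsTrivialization a p j O u E) (l : ℂ) :
    SmoothOn (fun z => E z l) O :=
  h.smooth.comp (φ := fun w => (w, l)) (by fun_prop) fun _ hw => ⟨hw, mem_univ _⟩

lemma IsTrivialization.smoothOn_dressingFrame (h : IsTrivialization a p j O u E) (α₁ α₂ : ℂ)
    (π : Mat n) : SmoothOn (fun z => dressingFrame (E z α₁) (E z α₂) π) O :=
  (((h.smoothOn_slice α₁).inv fun z hz => h.invertible z hz α₁).mul (SmoothOn.const π O)).add
    (((h.smoothOn_slice α₂).inv fun z hz => h.invertible z hz α₂).mul (SmoothOn.const (1 - π) O))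

lemma IsTrivialization.dressedProj_eq (h : IsTrivialization a p j O u E) (hπ : π * π = π)
    {z : ℝ × ℝ} (hz : z ∈ O)
    (hd : pullbackRange (E z α₁) π ⊓ pullbackRange (E z α₂) (1 - π) = ⊥) :
    dressedProj E α₁ α₂ π z = dressingFrame (E z α₁) (E z α₂) π * π
      * (dressingFrame (E z α₁) (E z α₂) π)⁻¹ :=
  projMatrix_pullbackRange (h.invertible z hz α₁) (h.invertible z hz α₂) hπ hd

lemma IsTrivialization.isUnit_dressingFrame (h : IsTrivialization a p j O u E) (hπ : π * π = π)
    {z : ℝ × ℝ} (hz : z ∈ O)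
    (hd : pullbackRange (E z α₁) π ⊓ pullbackRange (E z α₂) (1 - π) = ⊥) :
    IsUnit (dressingFrame (E z α₁) (E z α₂) π) :=
  _root_.isUnit_dressingFrame (h.invertible z hz α₁) (h.invertible z hz α₂) hπ hd

lemma IsTrivialization.smoothOn_dressedProj (h : IsTrivialization a p j O u E) (hπ : π * π = π)
    (hd : ∀ z ∈ O, pullbackRange (E z α₁) π ⊓ pullbackRange (E z α₂) (1 - π) = ⊥) :
    SmoothOn (dressedProj E α₁ α₂ π) O := by
  have hM := h.smoothOn_dressingFrame α₁ α₂ π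
  exact ((hM.mul (SmoothOn.const π O)).mul
    (hM.inv fun z hz => h.isUnit_dressingFrame hπ hz (hd z hz))).congr
      fun z hz => h.dressedProj_eq hπ hz (hd z hz)

lemma dressingFrame_one (π : Mat n) : dressingFrame 1 1 π = 1 := by
  simp [dressingFrame]

lemma IsTrivialization.solvesProjSystem_dressedProj (h : IsTrivialization a p j O u E)
    (hO : IsOpen O) (h0 : (0, 0) ∈ O) (hπ : π * π = π)
    (hd : ∀ z ∈ O, pullbackRange (E z α₁) π ⊓ pullbackRange (E z α₂) (1 - π) = ⊥) :
    SolvesProjSystem a p j O u α₁ α₂ π (dressedProj E α₁ α₂ π) := by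
  have heq := fun z hz => h.dressedProj_eq hπ hz (hd z hz)
  have hidem : ∀ z ∈ O, dressedProj E α₁ α₂ π z * dressedProj E α₁ α₂ π z
      = dressedProj E α₁ α₂ π z := fun z hz => by
    rw [heq z hz]
    exact conj_idem (h.isUnit_dressingFrame hπ hz (hd z hz)) hπ
  have s₁ := (h.smoothOn_slice α₁).inv fun z hz => h.invertible z hz α₁
  have s₂ := (h.smoothOn_slice α₂).inv fun z hz => h.invertible z hz α₂
  have sM := (h.smoothOn_dressingFrame α₁ α₂ π).inv
    fun z hz => h.isUnit_dressingFrame hπ hz (hd z hz)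
  refine ⟨fun z hz => ?_, fun z hz => ?_, hidem, ?_⟩
  · have ev := eventually_slice_x hO hz
    rw [← riccati_eq_x (hidem z hz)]
    refine HasMatDeriv.congr (hasMatDeriv_conj_dressingFrame (A₁ := fun s => E (s, z.2) α₁)
      (A₂ := fun s => E (s, z.2) α₂) hπ (h.eq_x z hz α₁) (h.eq_x z hz α₂)
      (s₁.hasPartialX hO hz) (s₂.hasPartialX hO hz) (sM.hasPartialX hO hz)
      (ev.mono fun r hr => h.invertible _ hr α₁) (ev.mono fun r hr => h.invertible _ hr α₂)
      (ev.mono fun r hr => h.isUnit_dressingFrame hπ hr (hd _ hr)) (heq z hz))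
      (ev.mono fun r hr => (heq _ hr).symm)
  · have ev := eventually_slice_t hO hz
    have et := fun l => h.eq_t z hz l
    simp only [flowSymbol_eq] at et
    have e : -(flowSymbol a p j u z α₁ * dressedProj E α₁ α₂ π z)
        + dressedProj E α₁ α₂ π z * flowSymbol a p j u z α₁ * dressedProj E α₁ α₂ π z
        + dressedProj E α₁ α₂ π z * flowSymbol a p j u z α₂ * (1 - dressedProj E α₁ α₂ π z) = _ :=
      riccati_eq_t (hidem z hz) α₁ α₂ j fun k => Qb a p u k z
    rw [← e]
    refine HasMatDeriv.congr (hasMatDeriv_conj_dressingFrame (A₁ := fun s => E (z.1, s) α₁)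
      (A₂ := fun s => E (z.1, s) α₂) hπ (et α₁) (et α₂)
      (s₁.hasPartialT_fderiv hO hz) (s₂.hasPartialT_fderiv hO hz) (sM.hasPartialT_fderiv hO hz)
      (ev.mono fun r hr => h.invertible _ hr α₁) (ev.mono fun r hr => h.invertible _ hr α₂)
      (ev.mono fun r hr => h.isUnit_dressingFrame hπ hr (hd _ hr)) (heq z hz))
      (ev.mono fun r hr => (heq _ hr).symm)
  · rw [heq _ h0, h.normalized, h.normalized, dressingFrame_one]
    simp

/-- The determinant of the frame is continuous and equals `1` at the origin, so a small ball works.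
-/
lemma IsTrivialization.exists_isConnected_inf_eq_bot (h : IsTrivialization a p j O u E)
    (hO : IsOpen O) (h0 : (0, 0) ∈ O) (hπ : π * π = π) :
    ∃ O' : Set (ℝ × ℝ), IsOpen O' ∧ IsConnected O' ∧ (0, 0) ∈ O' ∧ O' ⊆ O ∧
      ∀ z ∈ O', pullbackRange (E z α₁) π ⊓ pullbackRange (E z α₂) (1 - π) = ⊥ := by
  have hc : ContinuousAt (fun z => (dressingFrame (E z α₁) (E z α₂) π).det) (0, 0) :=
    (h.smoothOn_dressingFrame α₁ α₂ π).det.continuousOn.continuousAt (hO.mem_nhds h0)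
  have hne : (dressingFrame (E (0, 0) α₁) (E (0, 0) α₂) π).det ≠ 0 := by
    rw [h.normalized, h.normalized, dressingFrame_one, Matrix.det_one]
    exact one_ne_zero
  obtain ⟨r, hr, hball⟩ := Metric.eventually_nhds_iff_ball.mp
    ((hc.eventually_ne hne).and (hO.mem_nhds h0))
  refine ⟨Metric.ball (0, 0) r, Metric.isOpen_ball,
    ⟨⟨_, Metric.mem_ball_self hr⟩, (convex_ball _ _).isPreconnected⟩, Metric.mem_ball_self hr,
    fun z hz => (hball z hz).2, fun z hz => ?_⟩
  exact pullbackRange_inf_eq_bot (h.invertible z (hball z hz).2 α₁)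
    (h.invertible z (hball z hz).2 α₂) hπ
    ((Matrix.isUnit_iff_isUnit_det _).mpr (hball z hz).1.isUnit)

end DressedProjection

/-! ### The dressed wave function -/

section WaveFunction

open Set

variable {n : ℕ} {O O₁ : Set (ℝ × ℝ)} {W S : Set ℂ} {a : Fin n → ℂ} {p : Polynomial ℂ} {j : ℕ}
  {u : ℝ × ℝ → Mat n} {E E' m : ℝ × ℝ → ℂ → Mat n} {α₁ α₂ : ℂ} {π : Mat n} {σ : ℝ × ℝ → Mat n}

lemma compl_union_pair_mem_codiscreteWithin {S X : Set ℂ}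
    (h : Sᶜ ∈ Filter.codiscreteWithin X) (α₁ α₂ : ℂ) :
    (S ∪ {α₁, α₂})ᶜ ∈ Filter.codiscreteWithin X := by
  rw [compl_union]
  exact Filter.inter_mem h (compl_finite_mem_codiscreteWithin (Set.toFinite {α₁, α₂}))

/-- Uses `h̃⁻¹ = 1 + (α₂ - α₁)/(l - α₂) (1 - σ)`, valid once `‖l‖` exceeds `‖α₁‖ + ‖α₂‖`. -/
lemma HasExpansionAtInfty.dressed {Γ : Set ℂ} {c : ℕ → ℝ × ℝ → Mat n}
    (h : HasExpansionAtInfty O Γ m c) (hc : SmoothOn (c 0) O) (hσ : SmoothOn σ O)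
    (hσσ : ∀ z ∈ O, σ z * σ z = σ z) :
    HasExpansionAtInfty O Γ (fun z l => m z l * (simpleElement α₁ α₂ (σ z) l)⁻¹)
      (fun r z => c r z + divCoeff c α₂ r z * ((α₂ - α₁) • (1 - σ z))) := by
  have hB : SmoothOn (fun z => (α₂ - α₁) • (1 - σ z)) O :=
    SmoothOn.smul contDiffOn_const ((SmoothOn.const 1 O).sub hσ)
  have h1 := h.add ((h.div_sub hc α₂).mul_right hB)
  intro N K hK hKc
  obtain ⟨C, R, hC⟩ := h1 N K hK hKc
  refine ⟨C, max R (‖α₁‖ + ‖α₂‖ + 1), fun z hz l hl hR i k => ?_⟩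
  have hl' : ‖α₁‖ + ‖α₂‖ + 1 ≤ ‖l‖ := (le_max_right _ _).trans hR
  have e₁ : l ≠ α₁ := by
    rintro rfl
    linarith [norm_nonneg α₂]
  have e₂ : l ≠ α₂ := by
    rintro rfl
    linarith [norm_nonneg α₁]
  have e : m z l * (simpleElement α₁ α₂ (σ z) l)⁻¹
      = m z l + (l - α₂)⁻¹ • m z l * ((α₂ - α₁) • (1 - σ z)) := by
    have hne : l - α₂ ≠ 0 := sub_ne_zero.mpr e₂
    have : (l - α₂)⁻¹ • ((l - α₁) • 1 + (α₁ - α₂) • σ z)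
        = 1 + (l - α₂)⁻¹ • ((α₂ - α₁) • (1 - σ z)) := by
      have h2 : (l - α₁) • 1 + (α₁ - α₂) • σ z
          = (l - α₂) • 1 + (α₂ - α₁) • (1 - σ z) := by module
      rw [h2, smul_add, smul_smul, inv_mul_cancel₀ hne, one_smul]
    rw [simpleElement_inv _ _ (hσσ z (hK hz)) e₁ e₂, this, mul_add, mul_one, mul_smul_comm,
      smul_mul_assoc]
  simp only [e]
  exact hC z hz l hl ((le_max_left _ _).trans hR) i k

lemma IsReducedWaveFunction.dressed (hm : IsReducedWaveFunction a p j O₁ W S u E m)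
    (hO : O ⊆ O₁) (h0 : (0, 0) ∈ O) (hσ : SmoothOn σ O) (hσσ : ∀ z ∈ O, σ z * σ z = σ z)
    (hσ0 : σ (0, 0) = π)
    (hE' : ∀ z ∈ O, ∀ l, l ≠ α₁ → l ≠ α₂ → E' z l = simpleElement α₁ α₂ π l * E z l
        * (simpleElement α₁ α₂ (σ z) l)⁻¹)
    (hent : ∀ z ∈ O, ∀ i k, Differentiable ℂ fun l => E' z l i k) :
    IsReducedWaveFunction a p j O W (S ∪ {α₁, α₂})
      (fun z => u z + (α₁ - α₂) • ⁅Matrix.diagonal a, σ z⁆) E'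
      (fun z l => m z l * (simpleElement α₁ α₂ (σ z) l)⁻¹) := by
  have hoff : ∀ l ∈ (W \ scatteringRays a) \ (S ∪ {α₁, α₂}),
      l ∈ (W \ scatteringRays a) \ S ∧ l ≠ α₁ ∧ l ≠ α₂ := by
    rintro l ⟨h1, h2⟩
    simp only [mem_union, mem_insert_iff, mem_singleton_iff, not_or] at h2
    exact ⟨⟨h1, h2.1⟩, h2.2⟩
  refine ⟨hm.isOpen_domain, hm.domain_nhds_infty,
    hm.exceptional_bounded.union (Set.toFinite {α₁, α₂}).isBounded,
    compl_union_pair_mem_codiscreteWithin hm.exceptional_discrete α₁ α₂, ?_, fun z hz l hl => ?_,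
    fun z hz i k => ?_, fun z hz i k => ?_, ?_, hent, fun z hz l hl => ?_⟩
  · have h1 := hm.smooth.mono (O' := O ×ˢ ((W \ scatteringRays a) \ (S ∪ {α₁, α₂})))
      fun q hq => ⟨hO hq.1, (hoff q.2 hq.2).1⟩
    have h2 : SmoothOn (fun q : (ℝ × ℝ) × ℂ =>
        (q.2 - α₂)⁻¹ • ((q.2 - α₁) • (1 : Mat n) + (α₁ - α₂) • σ q.1))
        (O ×ˢ ((W \ scatteringRays a) \ (S ∪ {α₁, α₂}))) := by
      have hsnd : ContDiff ℝ ∞ fun q : (ℝ × ℝ) × ℂ => q.2 := contDiff_snd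
      refine SmoothOn.smul ?_ (SmoothOn.add (SmoothOn.smul ?_ (SmoothOn.const _ _))
        (SmoothOn.smul contDiffOn_const (hσ.comp contDiff_fst fun q hq => hq.1)))
      · exact (hsnd.contDiffOn.sub contDiffOn_const).inv
          fun q hq => sub_ne_zero.mpr (hoff q.2 hq.2).2.2
      · exact hsnd.contDiffOn.sub contDiffOn_const
    refine (h1.mul h2).congr fun q hq => ?_
    rw [simpleElement_inv _ _ (hσσ q.1 hq.1) (hoff q.2 hq.2).2.1 (hoff q.2 hq.2).2.2]
  · obtain ⟨h1, h2, h3⟩ := hoff l hl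
    refine (hm.invertible z (hO hz) l h1).mul ?_
    rw [Matrix.isUnit_nonsing_inv_iff]
    exact isUnit_simpleElement (hσσ z hz) h2 h3
  · have h1 : ∀ x, DifferentiableOn ℂ (fun l => m z l i x)
        ((W \ scatteringRays a) \ (S ∪ {α₁, α₂})) := fun x =>
      (hm.holomorphic z (hO hz) i x).mono fun l hl => (hoff l hl).1
    refine DifferentiableOn.congr (f := fun l =>
      ∑ x, m z l i x * ((l - α₂)⁻¹ * ((l - α₁) * (1 : Mat n) x k + (α₁ - α₂) * σ z x k))) ?_ ?_
    · refine DifferentiableOn.fun_sum fun x _ => (h1 x).mul (DifferentiableOn.mul ?_ (by fun_prop))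
      exact DifferentiableOn.inv (by fun_prop) fun l hl => sub_ne_zero.mpr (hoff l hl).2.2
    · intro l hl
      rw [simpleElement_inv _ _ (hσσ z hz) (hoff l hl).2.1 (hoff l hl).2.2, Matrix.mul_apply]
      simp [Matrix.smul_apply]
  · intro x hx
    have h1 : MeromorphicAt (fun l =>
        ∑ y, m z l i y * ((l - α₂)⁻¹ * ((l - α₁) * (1 : Mat n) y k + (α₁ - α₂) * σ z y k))) x := by
      refine MeromorphicAt.fun_sum fun y _ => (hm.meromorphic z (hO hz) i y x hx).mul ?_
      fun_prop
    refine h1.congr ?_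
    -- The point `x` may itself be `α₁` or `α₂`, but the formula for the inverse holds on a
    -- punctured neighborhood.
    have hne : ∀ α : ℂ, ∀ᶠ l in nhdsWithin x {x}ᶜ, l ≠ α := fun α => by
      by_cases hα : x = α
      · subst hα
        exact self_mem_nhdsWithin
      · exact eventually_nhdsWithin_of_eventually_nhds (eventually_ne_nhds hα)
    filter_upwards [hne α₁, hne α₂] with l h₁ h₂
    rw [simpleElement_inv _ _ (hσσ z hz) h₁ h₂, Matrix.mul_apply]
    simp [Matrix.smul_apply]
  · obtain ⟨c, hc, hc0, hexp, hcu⟩ := hm.expansion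
    have hcs : ∀ r, SmoothOn (c r) O := fun r => (hc r).mono hO
    refine ⟨_, fun r => (hcs r).add ((smoothOn_divCoeff hcs α₂ r).mul
      (SmoothOn.smul (contDiffOn_const (c := α₂ - α₁)) ((SmoothOn.const 1 O).sub hσ))),
      fun z hz => ?_, (hexp.mono hO).dressed (hcs 0) hσ hσσ, fun z hz => ?_⟩
    · simp [divCoeff, hc0 z (hO hz)]
    -- The new first coefficient is `c₁ + (α₂ - α₁)(1 - σ)`, whose commutator with `a` is the new
    -- potential.
    · rw [hcu z (hO hz)]
      simp only [divCoeff, hc0 z (hO hz), smul_zero, add_zero, one_mul]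
      simp only [Ring.lie_def, mul_add, add_mul, mul_sub, sub_mul, mul_smul_comm, smul_mul_assoc,
        mul_one, one_mul]
      module
  · obtain ⟨h1, h2, h3⟩ := hoff l hl
    have hid := hσσ _ h0
    -- Since `σ(0,0) = π`, the left factor `h m(0,0)⁻¹` is the inverse of the dressed wave function
    -- at the origin.
    rw [hE' z hz l h2 h3, hm.wave_eq z (hO hz) l h1, hσ0, Matrix.mul_inv_rev,
      Matrix.nonsing_inv_nonsing_inv]
    · simp only [mul_assoc]
    · rw [hσ0] at hid
      exact (Matrix.isUnit_iff_isUnit_det _).mp (isUnit_simpleElement hid h2 h3)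

end WaveFunction

theorem theorem4p3 {n : ℕ} (a : Fin n → ℂ) (ha : a ≠ 0) (ha_tr : ∑ i, a i = 0)
    (p : Polynomial ℂ) (j : ℕ) (hj : 0 < j)
    (O₁ : Set (ℝ × ℝ)) (hO₁ : IsOpen O₁) (h0 : ((0, 0) : ℝ × ℝ) ∈ O₁)
    (u : ℝ × ℝ → Mat n) (hu : IsLocalSolution a p j O₁ u)
    (E : ℝ × ℝ → ℂ → Mat n) (hE : IsTrivialization a p j O₁ u E)
    (W S : Set ℂ) (m : ℝ × ℝ → ℂ → Mat n) (hm : IsReducedWaveFunction a p j O₁ W S u E m)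
    (α₁ α₂ : ℂ) (π : Mat n) (hπ : π * π = π) :
    (∃ O : Set (ℝ × ℝ), IsOpen O ∧ IsConnected O ∧ (0, 0) ∈ O ∧ O ⊆ O₁ ∧
      ∀ z ∈ O, pullbackRange (E z α₁) π ⊓ pullbackRange (E z α₂) (1 - π) = ⊥) ∧
    ∀ O : Set (ℝ × ℝ), IsOpen O → (0, 0) ∈ O → O ⊆ O₁ →
      (∀ z ∈ O, pullbackRange (E z α₁) π ⊓ pullbackRange (E z α₂) (1 - π) = ⊥) →
      (∀ z ∈ O, IsCompl (pullbackRange (E z α₁) π) (pullbackRange (E z α₂) (1 - π))) ∧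
      IsLocalSolution a p j O
        (fun z => u z + (α₁ - α₂) • ⁅Matrix.diagonal a, dressedProj E α₁ α₂ π z⁆) ∧
      (∃ E' : ℝ × ℝ → ℂ → Mat n,
        (∀ z ∈ O, ∀ l, l ≠ α₁ → l ≠ α₂ →
          E' z l = simpleElement α₁ α₂ π l * E z l
            * (simpleElement α₁ α₂ (dressedProj E α₁ α₂ π z) l)⁻¹) ∧
        IsTrivialization a p j O
          (fun z => u z + (α₁ - α₂) • ⁅Matrix.diagonal a, dressedProj E α₁ α₂ π z⁆) E' ∧
        IsReducedWaveFunction a p j O W (S ∪ {α₁, α₂})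
          (fun z => u z + (α₁ - α₂) • ⁅Matrix.diagonal a, dressedProj E α₁ α₂ π z⁆) E'
          (fun z l => m z l * (simpleElement α₁ α₂ (dressedProj E α₁ α₂ π z) l)⁻¹)) ∧
      SmoothOn (dressedProj E α₁ α₂ π) O ∧
      SolvesProjSystem a p j O u α₁ α₂ π (dressedProj E α₁ α₂ π) ∧
      (IsPreconnected O → ∀ σ : ℝ × ℝ → Mat n,
        SolvesProjSystem a p j O u α₁ α₂ π σ → Set.EqOn σ (dressedProj E α₁ α₂ π) O) := by
  refine ⟨hE.exists_isConnected_inf_eq_bot hO₁ h0 hπ, fun O hO h0' hsub hd => ?_⟩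
  have hEO := hE.mono hsub
  have huO := hu.smooth.mono hsub
  have hσs := hEO.smoothOn_dressedProj hπ hd
  have hσ := hEO.solvesProjSystem_dressedProj hO h0' hπ hd
  have hconj := fun z hz => hEO.dressedProj_eq hπ hz (hd z hz)
  have hunit := fun z hz => hEO.isUnit_dressingFrame hπ hz (hd z hz)
  obtain ⟨E', hE', hE's, hE'd⟩ := exists_dressed hO hEO.smooth
    (fun z hz => hm.entire z (hsub hz)) hσs hσ.idem
    (fun z hz => by
      rw [hconj z hz]
      exact one_sub_mul_mul_conj_dressingFrame (hEO.invertible z hz α₁) hπ _)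
    (fun z hz => by
      rw [hconj z hz, one_sub_conj (hunit z hz)]
      exact mul_mul_conj_dressingFrame (hEO.invertible z hz α₂) hπ _)
  have htriv := isTrivialization_dressed hO h0' huO hEO hσ
    (fun z hz => ⟨_, hunit z hz, hconj z hz⟩) hE' hE's
  have hu's : SmoothOn
      (fun z => u z + (α₁ - α₂) • ⁅Matrix.diagonal a, dressedProj E α₁ α₂ π z⁆) O :=
    huO.add (SmoothOn.smul contDiffOn_const ((SmoothOn.const _ O).lie hσs))
  -- The flow equation is deduced from the dressed trivialization, without differentiating the new
  -- potential directly.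
  refine ⟨fun z hz => isCompl_pullbackRange (hEO.invertible z hz α₁) (hEO.invertible z hz α₂) hπ
    (hd z hz), ⟨hu's, fun z hz => add_smul_mem_slPerp (hu.mem_perp z (hsub hz))
    (lie_diagonal_mem_slPerp a _) _, fun z hz => htriv.flow hO hu's hz⟩,
    ⟨E', hE', htriv, hm.dressed hsub h0' hσs hσ.idem hσ.initial hE' hE'd⟩, hσs, hσ,
    fun hc σ hσ' => hσ'.unique hO hc h0' huO hσ⟩
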